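/- **Theorem (EBM to protocol).** All Hilbert spaces are finite-dimensional and complex, and $X\preceq Y$ means that $Y-X$ is positive semidefinite. *Point games.* For a positive semidefinite matrix $Z$ and a vector $\psi$ let $\mathrm{prob}[Z,\psi]:[0,\infty)\to[0,\infty)$ be $z\mapsto\langle\psi|\Pi^{[z]}|\psi\rangle$, where $\Pi^{[z]}$ is the orthogonal projector onto the eigenspace of $Z$ for $z$ (so the value is $0$ if $z$ is not an eigenvalue). For functions $l,r:[0,\infty)\to[0,\infty)$ of finite support, the line transition $l\to r$ is *expressible by matrices* (EBM) if there are matrices $0\preceq X\preceq Y$ and a (not necessarily unit) vector $\psi$ with $l=\mathrm{prob}[X,\psi]$ and $r=\mathrm{prob}[Y,\psi]$. For finitely supported $p,q:[0,\infty)^2\to[0,\infty)$, the transition $p\to q$ is EBM horizontal (resp. vertical) if $p(\cdot,y)\to q(\cdot,y)$ is EBM for all $y\ge 0$ (resp. $p(x,\cdot)\to q(x,\cdot)$ is EBM for all $x\ge 0$). Write $[x,y]$ for the indicator function of the point $(x,y)$. An *EBM point game with final point $[\beta,\alpha]$* is a sequence $p_0,\dots,p_n$ of finitely supported functions with $p_0=\frac12[0,1]+\frac12[1,0]$,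 $p_n=1[\beta,\alpha]$, and $p_i\to p_{i+1}$ EBM vertical for even $i$ and EBM horizontal for odd $i$ ($0\le i<n$). *Protocols.* For $N$ even, an $N$-message weak coin flipping (WCF) protocol consists of spaces $\mathcal A,\mathcal M,\mathcal B$; unit vectors $\psi_{A,0},\psi_{M,0},\psi_{B,0}$ in them, with $\psi_0=\psi_{A,0}\otimes\psi_{M,0}\otimes\psi_{B,0}$; for $1\le i\le N$ a unitary $U_i$ and an orthogonal projector $E_i$ on $\mathcal A\otimes\mathcal M\otimes\mathcal B$, of the form $U_i=U_{A,i}\otimes I_{\mathcal B}$, $E_i=E_{A,i}\otimes I_{\mathcal B}$ for $i$ odd and $U_i=I_{\mathcal A}\otimes U_{B,i}$, $E_i=I_{\mathcal A}\otimes E_{B,i}$ for $i$ even, with $E_i\psi_i=\psi_i$ for the honest states $\psi_i=U_i\cdots U_1\psi_0$; and POVMs $\{\Pi_A^{(0)},\Pi_A^{(1)}\}$ on $\mathcal A$, $\{\Pi_B^{(0)},\Pi_B^{(1)}\}$ on $\mathcal B$, such that $(\Pi_A^{(0)}\otimes I\otimes\Pi_B^{(1)})\psi_N=(\Pi_A^{(1)}\otimes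 I\otimes\Pi_B^{(0)})\psi_N=0$ and $\|(\Pi_A^{(0)}\otimes I\otimes\Pi_B^{(0)})\psi_N\|^2=\|(\Pi_A^{(1)}\otimes I\otimes\Pi_B^{(1)})\psi_N\|^2=\frac12$. Alice prepares $\psi_{A,0}\otimes\psi_{M,0}$ and Bob $\psi_{B,0}$; in round $i$ Alice ($i$ odd) or Bob ($i$ even) applies $U_i$, measures $\{E_i,I-E_i\}$, declares herself/himself the winner on the second outcome and sends the message register on the first; at the end both measure their POVM, Alice winning on $0$ and Bob on $1$. *Cheating probabilities.* $P_B^*$ is the supremum, over all strategies of a cheating Bob (an arbitrary workspace, an initial state of it, and arbitrary quantum operations on message space and workspace in the even rounds), of the probability that honest Alice passes all her tests $E_i$ and outputs $1$. $P_A^*$ is the supremum, over all strategies of a cheating Alice (who prepares an arbitrary joint state of her workspace and the message space and applies arbitrary quantum operations to them in the odd rounds), of the probability that honest Bob passes all his tests and outputs $0$. The corresponding semidefinite programs are as follows. For $P_B^*$: the supremum of $\mathrm{Tr}((\Pi_A^{(1)}\otimes I)\rho_N)$ over $\rho_0,\dots,\rho_N\succeq0$ on $\mathcal A\otimes\mathcal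 M$ with $\mathrm{Tr}_{\mathcal M}\rho_0=|\psi_{A,0}\rangle\langle\psi_{A,0}|$, $\mathrm{Tr}_{\mathcal M}\rho_i=\mathrm{Tr}_{\mathcal M}(E_{A,i}U_{A,i}\rho_{i-1}U_{A,i}^\dagger E_{A,i})$ for $i$ odd and $\mathrm{Tr}_{\mathcal M}\rho_i=\mathrm{Tr}_{\mathcal M}\rho_{i-1}$ for $i$ even. For $P_A^*$: the supremum of $\mathrm{Tr}((I\otimes\Pi_B^{(0)})\rho_N)$ over $\rho_0,\dots,\rho_N\succeq0$ on $\mathcal M\otimes\mathcal B$ with $\mathrm{Tr}_{\mathcal M}\rho_0=|\psi_{B,0}\rangle\langle\psi_{B,0}|$, $\mathrm{Tr}_{\mathcal M}\rho_i=\mathrm{Tr}_{\mathcal M}(E_{B,i}U_{B,i}\rho_{i-1}U_{B,i}^\dagger E_{B,i})$ for $i$ even and $\mathrm{Tr}_{\mathcal M}\rho_i=\mathrm{Tr}_{\mathcal M}\rho_{i-1}$ for $i$ odd. *Dual feasible points.* Matrices $Z_{A,0},\dots,Z_{A,N}\succeq0$ on $\mathcal A$ form a dual feasible point with eigenvalue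 $\beta>0$ if $Z_{A,i-1}\otimes I_{\mathcal M}\succeq U_{A,i}^\dagger E_{A,i}(Z_{A,i}\otimes I_{\mathcal M})E_{A,i}U_{A,i}$ for $i$ odd, $Z_{A,i-1}=Z_{A,i}$ for $i$ even, $Z_{A,N}=\Pi_A^{(1)}$ and $Z_{A,0}\psi_{A,0}=\beta\psi_{A,0}$. Matrices $Z_{B,0},\dots,Z_{B,N}\succeq0$ on $\mathcal B$ form a dual feasible point with eigenvalue $\alpha>0$ if $I_{\mathcal M}\otimes Z_{B,i-1}\succeq U_{B,i}^\dagger E_{B,i}(I_{\mathcal M}\otimes Z_{B,i})E_{B,i}U_{B,i}$ for $i$ even, $Z_{B,i-1}=Z_{B,i}$ for $i$ odd, $Z_{B,N}=\Pi_B^{(0)}$ and $Z_{B,0}\psi_{B,0}=\alpha\psi_{B,0}$. *Statement.* Given an EBM point game with final point $[\beta,\alpha]$, there exist a WCF protocol, a dual feasible point $\{Z_{A,i}\}$ with eigenvalue $\beta$ and a dual feasible point $\{Z_{B,i}\}$ with eigenvalue $\alpha$, and for this protocol $P_A^*\le\alpha$ and $P_B^*\le\beta$; moreover the values of the two semidefinite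 programs above are at most $\alpha$ and $\beta$, respectively. -/

import Mathlib

open scoped NNReal Kronecker ComplexOrder

noncomputable section

namespace WCF

/-! ## Point games with transitions expressible by matrices -/

/-- `prob[Z, ψ](z) = ⟨ψ| Π^[z] |ψ⟩`, with `Π^[z]` the orthogonal projector onto the eigenspace of
`Z` for `z`. If `z` is not an eigenvalue, the eigenspace is trivial and the value is `0`. -/
def prob {d : ℕ} (Z : Matrix (Fin d) (Fin d) ℂ) (ψ : EuclideanSpace ℂ (Fin d)) (z : ℝ≥0) : ℝ :=
  (inner ℂ ψ
    ((Module.End.eigenspace (Matrix.toEuclideanLin Z) ((z : ℝ) : ℂ)).starProjection ψ)).re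

/-- The line transition `l → r` is expressible by matrices: `l = prob[X, ψ]`, `r = prob[Y, ψ]`
for some matrices `0 ⪯ X ⪯ Y` and a (not necessarily unit) vector `ψ`. -/
def EBMLine (l r : ℝ≥0 → ℝ≥0) : Prop :=
  ∃ (d : ℕ) (X Y : Matrix (Fin d) (Fin d) ℂ) (ψ : EuclideanSpace ℂ (Fin d)),
    X.PosSemidef ∧ (Y - X).PosSemidef ∧
      (∀ z, (l z : ℝ) = prob X ψ z) ∧ (∀ z, (r z : ℝ) = prob Y ψ z)

/-- Horizontal EBM transition: EBM along every horizontal line. -/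
def EBMHorizontal (p q : ℝ≥0 × ℝ≥0 →₀ ℝ≥0) : Prop :=
  ∀ y : ℝ≥0, EBMLine (fun x => p (x, y)) (fun x => q (x, y))

/-- Vertical EBM transition: EBM along every vertical line. -/
def EBMVertical (p q : ℝ≥0 × ℝ≥0 →₀ ℝ≥0) : Prop :=
  ∀ x : ℝ≥0, EBMLine (fun y => p (x, y)) (fun y => q (x, y))

/-- `p 0, …, p n` is an EBM point game with final point `[β, α]`. -/
structure IsEBMPointGame (n : ℕ) (p : ℕ → (ℝ≥0 × ℝ≥0 →₀ ℝ≥0)) (β α : ℝ≥0) : Prop where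
  init : p 0 = Finsupp.single (0, 1) (1 / 2) + Finsupp.single (1, 0) (1 / 2)
  vertical : ∀ i < n, Even i → EBMVertical (p i) (p (i + 1))
  horizontal : ∀ i < n, Odd i → EBMHorizontal (p i) (p (i + 1))
  final : p n = Finsupp.single (β, α) 1

/-! ## Tensor products

The finite-dimensional spaces are `ℂ^A`, `ℂ^M`, `ℂ^B` for finite index types; their tensor product
has index type `A × M × B`. -/

section Tensor

variable {A M B : Type}

/-- Identification of operators on `(𝒜 ⊗ ℳ) ⊗ ℬ` with operators on `𝒜 ⊗ ℳ ⊗ ℬ`. -/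
def assocOp (X : Matrix ((A × M) × B) ((A × M) × B) ℂ) :
    Matrix (A × M × B) (A × M × B) ℂ :=
  Matrix.reindex (Equiv.prodAssoc A M B) (Equiv.prodAssoc A M B) X

/-- `X ⊗ I_ℬ` for `X` acting on `𝒜 ⊗ ℳ`. -/
def liftAM [DecidableEq B] (X : Matrix (A × M) (A × M) ℂ) : Matrix (A × M × B) (A × M × B) ℂ :=
  assocOp (X ⊗ₖ (1 : Matrix B B ℂ))

/-- `I_𝒜 ⊗ X` for `X` acting on `ℳ ⊗ ℬ`. -/
def liftMB [DecidableEq A] (X : Matrix (M × B) (M × B) ℂ) : Matrix (A × M × B) (A × M × B) ℂ :=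
  (1 : Matrix A A ℂ) ⊗ₖ X

/-- `tr_ℳ` of an operator on `𝒜 ⊗ ℳ`. -/
def traceMRight [Fintype M] (ρ : Matrix (A × M) (A × M) ℂ) : Matrix A A ℂ :=
  fun a a' => ∑ m, ρ (a, m) (a', m)

/-- `tr_ℳ` of an operator on `ℳ ⊗ ℬ`. -/
def traceMLeft [Fintype M] (ρ : Matrix (M × B) (M × B) ℂ) : Matrix B B ℂ :=
  fun b b' => ∑ m, ρ (m, b) (m, b')

/-- `|v⟩⟨v|`. -/
def ketbra (v : A → ℂ) : Matrix A A ℂ := Matrix.vecMulVec v (star v)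

/-- `‖v‖²` (Euclidean norm). -/
def normSq [Fintype A] (v : A → ℂ) : ℝ := ∑ x, ‖v x‖ ^ 2

end Tensor

/-! ## Weak coin flipping protocols -/

/-- The data of a protocol on `𝒜 ⊗ ℳ ⊗ ℬ`. In an `n`-message protocol `UA i`, `EA i` are used for
odd `1 ≤ i ≤ n` and `UB i`, `EB i` for even `1 ≤ i ≤ n`; other entries are irrelevant. -/
structure Scheme (A M B : Type) where
  ψA : A → ℂ
  ψM : M → ℂ
  ψB : B → ℂ
  UA : ℕ → Matrix (A × M) (A × M) ℂ
  UB : ℕ → Matrix (M × B) (M × B) ℂ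
  EA : ℕ → Matrix (A × M) (A × M) ℂ
  EB : ℕ → Matrix (M × B) (M × B) ℂ
  /-- Alice's final POVM. -/
  povmA : Fin 2 → Matrix A A ℂ
  /-- Bob's final POVM. -/
  povmB : Fin 2 → Matrix B B ℂ

namespace Scheme

variable {A M B : Type} [Fintype A] [Fintype M] [Fintype B]
  [DecidableEq A] [DecidableEq M] [DecidableEq B] (P : Scheme A M B)

/-- `U_i`: `U_{A,i} ⊗ I_ℬ` for `i` odd, `I_𝒜 ⊗ U_{B,i}` for `i` even. -/
def U (i : ℕ) : Matrix (A × M × B) (A × M × B) ℂ :=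
  if Odd i then liftAM (P.UA i) else liftMB (P.UB i)

/-- `E_i`: `E_{A,i} ⊗ I_ℬ` for `i` odd, `I_𝒜 ⊗ E_{B,i}` for `i` even. -/
def E (i : ℕ) : Matrix (A × M × B) (A × M × B) ℂ :=
  if Odd i then liftAM (P.EA i) else liftMB (P.EB i)

/-- The honest states `ψ_i = U_i ⋯ U_1 (ψ_{A,0} ⊗ ψ_{M,0} ⊗ ψ_{B,0})`. -/
def honest : ℕ → (A × M × B → ℂ)
  | 0 => fun x => P.ψA x.1 * P.ψM x.2.1 * P.ψB x.2.2
  | i + 1 => (P.U (i + 1)).mulVec (honest i)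

/-- `Π_A^{(a)} ⊗ I_ℳ ⊗ Π_B^{(b)}`. -/
def outcome (a b : Fin 2) : Matrix (A × M × B) (A × M × B) ℂ :=
  P.povmA a ⊗ₖ ((1 : Matrix M M ℂ) ⊗ₖ P.povmB b)

/-- The scheme is an `n`-message weak coin flipping protocol: correct and balanced. -/
structure IsProtocol (n : ℕ) : Prop where
  even : Even n
  ψA_unit : normSq P.ψA = 1
  ψM_unit : normSq P.ψM = 1
  ψB_unit : normSq P.ψB = 1
  UA_unitary : ∀ i, 1 ≤ i → i ≤ n → Odd i → P.UA i ∈ Matrix.unitaryGroup (A × M) ℂ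
  UB_unitary : ∀ i, 1 ≤ i → i ≤ n → Even i → P.UB i ∈ Matrix.unitaryGroup (M × B) ℂ
  EA_proj : ∀ i, 1 ≤ i → i ≤ n → Odd i → IsStarProjection (P.EA i)
  EB_proj : ∀ i, 1 ≤ i → i ≤ n → Even i → IsStarProjection (P.EB i)
  E_honest : ∀ i, 1 ≤ i → i ≤ n → (P.E i).mulVec (P.honest i) = P.honest i
  povmA_pos : ∀ c, (P.povmA c).PosSemidef
  povmA_sum : P.povmA 0 + P.povmA 1 = 1
  povmB_pos : ∀ c, (P.povmB c).PosSemidef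
  povmB_sum : P.povmB 0 + P.povmB 1 = 1
  correct01 : (P.outcome 0 1).mulVec (P.honest n) = 0
  correct10 : (P.outcome 1 0).mulVec (P.honest n) = 0
  balanced_A : normSq ((P.outcome 0 0).mulVec (P.honest n)) = 1 / 2
  balanced_B : normSq ((P.outcome 1 1).mulVec (P.honest n)) = 1 / 2

end Scheme

/-! ## Cheating strategies and cheating probabilities -/

/-- A strategy of a cheating Bob: a finite-dimensional workspace, an initial state of it, and for
every round a quantum operation (in Kraus form) on message space and workspace. -/
structure BobStrategy (M : Type) [Fintype M] [DecidableEq M] where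
  d : ℕ
  σ : Matrix (Fin d) (Fin d) ℂ
  σ_pos : σ.PosSemidef
  σ_trace : σ.trace = 1
  κ : ℕ
  K : ℕ → Fin κ → Matrix (M × Fin d) (M × Fin d) ℂ
  K_tp : ∀ i, ∑ k, (K i k).conjTranspose * K i k = 1

/-- A strategy of a cheating Alice. She holds the message space at the beginning, so she prepares
an arbitrary joint state of her workspace and the message space. -/
structure AliceStrategy (M : Type) [Fintype M] [DecidableEq M] where
  d : ℕ
  σ : Matrix (Fin d × M) (Fin d × M) ℂ
  σ_pos : σ.PosSemidef
  σ_trace : σ.trace = 1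
  κ : ℕ
  K : ℕ → Fin κ → Matrix (Fin d × M) (Fin d × M) ℂ
  K_tp : ∀ i, ∑ k, (K i k).conjTranspose * K i k = 1

namespace Scheme

variable {A M B : Type} [Fintype A] [Fintype M] [Fintype B]
  [DecidableEq A] [DecidableEq M] [DecidableEq B] (P : Scheme A M B)

/-- The unnormalized global state after message `i` when Alice is honest (and has not caught Bob
so far) and Bob plays the strategy `s`. -/
def stateVsBob (s : BobStrategy M) : ℕ → Matrix (A × M × Fin s.d) (A × M × Fin s.d) ℂ
  | 0 => ketbra P.ψA ⊗ₖ (ketbra P.ψM ⊗ₖ s.σ)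
  | i + 1 =>
    if Odd (i + 1) then
      liftAM (P.EA (i + 1) * P.UA (i + 1)) * stateVsBob s i *
        (liftAM (P.EA (i + 1) * P.UA (i + 1))).conjTranspose
    else
      ∑ k, liftMB (s.K (i + 1) k) * stateVsBob s i * (liftMB (s.K (i + 1) k)).conjTranspose

/-- The unnormalized global state after message `i` when Bob is honest (and has not caught Alice
so far) and Alice plays the strategy `s`. -/
def stateVsAlice (s : AliceStrategy M) : ℕ → Matrix (Fin s.d × M × B) (Fin s.d × M × B) ℂ
  | 0 => assocOp (s.σ ⊗ₖ ketbra P.ψB)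
  | i + 1 =>
    if Odd (i + 1) then
      ∑ k, liftAM (s.K (i + 1) k) * stateVsAlice s i * (liftAM (s.K (i + 1) k)).conjTranspose
    else
      liftMB (P.EB (i + 1) * P.UB (i + 1)) * stateVsAlice s i *
        (liftMB (P.EB (i + 1) * P.UB (i + 1))).conjTranspose

/-- `P_B^*` of the `n`-message protocol: the supremum, over all strategies of a cheating Bob, of the
probability that honest Alice never catches him and outputs `1`. -/
def cheatB (n : ℕ) : EReal :=
  ⨆ s : BobStrategy M,
    (((P.povmA 1 ⊗ₖ (1 : Matrix (M × Fin s.d) (M × Fin s.d) ℂ)) *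
      P.stateVsBob s n).trace.re : EReal)

/-- `P_A^*` of the `n`-message protocol: the supremum, over all strategies of a cheating Alice, of
the probability that honest Bob never catches her and outputs `0`. -/
def cheatA (n : ℕ) : EReal :=
  ⨆ s : AliceStrategy M,
    (((liftMB ((1 : Matrix M M ℂ) ⊗ₖ P.povmB 0) : Matrix (Fin s.d × M × B) (Fin s.d × M × B) ℂ) *
      P.stateVsAlice s n).trace.re : EReal)

/-! ## The semidefinite programs -/

/-- The constraints of the primal program for cheating Bob, on the states `ρ_{AM,i}`. -/
structure PrimalB (n : ℕ) (ρ : ℕ → Matrix (A × M) (A × M) ℂ) : Prop where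
  pos : ∀ i ≤ n, (ρ i).PosSemidef
  init : traceMRight (ρ 0) = ketbra P.ψA
  odd : ∀ i < n, Odd (i + 1) → traceMRight (ρ (i + 1)) =
    traceMRight (P.EA (i + 1) * P.UA (i + 1) * ρ i *
      (P.UA (i + 1)).conjTranspose * P.EA (i + 1))
  even : ∀ i < n, Even (i + 1) → traceMRight (ρ (i + 1)) = traceMRight (ρ i)

/-- The constraints of the primal program for cheating Alice, on the states `ρ_{MB,i}`. -/
structure PrimalA (n : ℕ) (ρ : ℕ → Matrix (M × B) (M × B) ℂ) : Prop where
  pos : ∀ i ≤ n, (ρ i).PosSemidef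
  init : traceMLeft (ρ 0) = ketbra P.ψB
  even : ∀ i < n, Even (i + 1) → traceMLeft (ρ (i + 1)) =
    traceMLeft (P.EB (i + 1) * P.UB (i + 1) * ρ i *
      (P.UB (i + 1)).conjTranspose * P.EB (i + 1))
  odd : ∀ i < n, Odd (i + 1) → traceMLeft (ρ (i + 1)) = traceMLeft (ρ i)

/-- Value of the primal program for cheating Bob. -/
def primalValueB (n : ℕ) : EReal :=
  ⨆ (ρ : ℕ → Matrix (A × M) (A × M) ℂ) (_ : P.PrimalB n ρ),
    (((P.povmA 1 ⊗ₖ (1 : Matrix M M ℂ)) * ρ n).trace.re : EReal)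

/-- Value of the primal program for cheating Alice. -/
def primalValueA (n : ℕ) : EReal :=
  ⨆ (ρ : ℕ → Matrix (M × B) (M × B) ℂ) (_ : P.PrimalA n ρ),
    ((((1 : Matrix M M ℂ) ⊗ₖ P.povmB 0) * ρ n).trace.re : EReal)

/-- `Z_{A,0}, …, Z_{A,n}` is a dual feasible point with `Z_{A,0} ψ_{A,0} = β ψ_{A,0}`, `β > 0`. -/
structure DualFeasibleA (n : ℕ) (Z : ℕ → Matrix A A ℂ) (β : ℝ) : Prop where
  pos : ∀ i ≤ n, (Z i).PosSemidef
  odd : ∀ i < n, Odd (i + 1) →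
    (Z i ⊗ₖ (1 : Matrix M M ℂ) - (P.UA (i + 1)).conjTranspose * P.EA (i + 1) *
      (Z (i + 1) ⊗ₖ (1 : Matrix M M ℂ)) * P.EA (i + 1) * P.UA (i + 1)).PosSemidef
  even : ∀ i < n, Even (i + 1) → Z i = Z (i + 1)
  final : Z n = P.povmA 1
  eigenvalue_pos : 0 < β
  eigenvector : (Z 0).mulVec P.ψA = (β : ℂ) • P.ψA

/-- `Z_{B,0}, …, Z_{B,n}` is a dual feasible point with `Z_{B,0} ψ_{B,0} = α ψ_{B,0}`, `α > 0`. -/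
structure DualFeasibleB (n : ℕ) (Z : ℕ → Matrix B B ℂ) (α : ℝ) : Prop where
  pos : ∀ i ≤ n, (Z i).PosSemidef
  even : ∀ i < n, Even (i + 1) →
    ((1 : Matrix M M ℂ) ⊗ₖ Z i - (P.UB (i + 1)).conjTranspose * P.EB (i + 1) *
      ((1 : Matrix M M ℂ) ⊗ₖ Z (i + 1)) * P.EB (i + 1) * P.UB (i + 1)).PosSemidef
  odd : ∀ i < n, Odd (i + 1) → Z i = Z (i + 1)
  final : Z n = P.povmB 0
  eigenvalue_pos : 0 < α
  eigenvector : (Z 0).mulVec P.ψB = (α : ℂ) • P.ψB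

end Scheme

end WCF

end

set_option linter.unusedSectionVars false

/-! The point game is run backwards. Both parties have a space spanned by labels, which are the
coordinates occurring in the game plus `D` extra labels, and the message holds a copy of each label.
The honest states are `∑ √q(a, b) |a⟩|a, b⟩|b⟩`, from the product state at the final point to a
superposition of the two starting points, which announce opposite winners. The dual matrix of each
party is diagonal, with a label's coordinate as its entry, so the final point supplies the
eigenvalues `β` and `α`.

Each transition must become a unitary followed by a check under which this diagonal form does not
grow. For `0 ⪯ X ⪯ Y` and `ψ`, decompose `ψ` along eigenvectors `e` of `X` and `f` of `Y`. Identify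
each nonzero `f x` with the label `x` and the rest of the space with extra labels; the unitary reads
off the coefficients along `e`. The inequality then follows from `⟨u, X u⟩ ≤ ⟨u, Y u⟩`, provided
that the extra labels have a value at least `‖Y‖`. The check discards the rows in which `e` had to
be completed to a basis. This is `EBMLine.eventually_isLineStep`.

A party does not know the label of the other and uses the copy in the message as a control. The
check that its own copy is correct reduces the dual constraint to one line at a time
(`posSemidef_kronecker_sub_controlled`). In a party's last active round the diagonal matrix is
replaced by the projector onto the label `1`, which it dominates. Weak duality, with `Tr((Z_i ⊗ I)
ρ_i)` as a nonincreasing potential, bounds the cheating probabilities and the semidefinite programs.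
-/

namespace WCF

/-! ## Weak duality -/

open scoped MatrixOrder in
theorem _root_.Matrix.PosSemidef.trace_mul_re_nonneg {n : Type*} [Fintype n] [DecidableEq n]
    {X Y : Matrix n n ℂ} (hX : X.PosSemidef) (hY : Y.PosSemidef) : 0 ≤ (X * Y).trace.re := by
  obtain ⟨C, rfl⟩ : ∃ C : Matrix n n ℂ, Y = C.conjTranspose * C :=
    CStarAlgebra.nonneg_iff_eq_star_mul_self.mp hY.nonneg
  rw [← mul_assoc, Matrix.trace_mul_comm, ← mul_assoc]
  exact (Complex.nonneg_iff.mp (hX.mul_mul_conjTranspose_same C).trace_nonneg).1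

theorem _root_.Matrix.trace_mul_re_le_of_posSemidef_sub {n : Type*} [Fintype n] [DecidableEq n]
    {X Y ρ : Matrix n n ℂ} (hXY : (Y - X).PosSemidef) (hρ : ρ.PosSemidef) :
    (X * ρ).trace.re ≤ (Y * ρ).trace.re := by
  have h := hXY.trace_mul_re_nonneg hρ
  rw [sub_mul, Matrix.trace_sub, Complex.sub_re] at h
  linarith

theorem trace_conj_mul {n : Type*} [Fintype n] (X V ρ : Matrix n n ℂ) :
    (X * (V * ρ * V.conjTranspose)).trace = (V.conjTranspose * X * V * ρ).trace := by
  rw [← mul_assoc, Matrix.trace_mul_comm, ← mul_assoc, ← mul_assoc]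

/-! ### Tensor factors, partial traces and pure states. -/

section Tensor

variable {A M B : Type} [Fintype A] [Fintype M] [Fintype B]

theorem assocOp_mul (X Y : Matrix ((A × M) × B) ((A × M) × B) ℂ) :
    assocOp (X * Y) = assocOp X * assocOp Y := by
  simp [assocOp]

theorem assocOp_conjTranspose (X : Matrix ((A × M) × B) ((A × M) × B) ℂ) :
    (assocOp X).conjTranspose = assocOp X.conjTranspose := by
  simp [assocOp]

theorem assocOp_sub (X Y : Matrix ((A × M) × B) ((A × M) × B) ℂ) :
    assocOp (X - Y) = assocOp X - assocOp Y :=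
  rfl

theorem assocOp_sum {κ : Type*} [Fintype κ] (X : κ → Matrix ((A × M) × B) ((A × M) × B) ℂ) :
    assocOp (∑ k, X k) = ∑ k, assocOp (X k) := by
  ext i j
  simp [assocOp, Matrix.sum_apply]

theorem sum_kronecker {κ m n : Type*} [Fintype κ] (X : κ → Matrix m m ℂ) (Z : Matrix n n ℂ) :
    ∑ k, X k ⊗ₖ Z = (∑ k, X k) ⊗ₖ Z := by
  ext i j
  simp [Matrix.sum_apply, Finset.sum_mul]

theorem kronecker_sum {κ m n : Type*} [Fintype κ] (Z : Matrix m m ℂ) (X : κ → Matrix n n ℂ) :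
    ∑ k, Z ⊗ₖ X k = Z ⊗ₖ ∑ k, X k := by
  ext i j
  simp [Matrix.sum_apply, Finset.mul_sum]

theorem assocOp_posSemidef {X : Matrix ((A × M) × B) ((A × M) × B) ℂ} (hX : X.PosSemidef) :
    (assocOp X).PosSemidef :=
  hX.submatrix _

theorem trace_assocOp (X : Matrix ((A × M) × B) ((A × M) × B) ℂ) :
    (assocOp X).trace = X.trace :=
  (Equiv.prodAssoc A M B).symm.sum_comp fun i => X i i

theorem liftAM_mul [DecidableEq B] (X Y : Matrix (A × M) (A × M) ℂ) :
    (liftAM (X * Y) : Matrix (A × M × B) (A × M × B) ℂ) = liftAM X * liftAM Y := by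
  rw [liftAM, liftAM, liftAM, ← assocOp_mul, ← Matrix.mul_kronecker_mul, mul_one]

theorem liftAM_conjTranspose [DecidableEq B] (X : Matrix (A × M) (A × M) ℂ) :
    (liftAM X : Matrix (A × M × B) (A × M × B) ℂ).conjTranspose = liftAM X.conjTranspose := by
  rw [liftAM, liftAM, assocOp_conjTranspose, Matrix.conjTranspose_kronecker,
    Matrix.conjTranspose_one]

theorem liftAM_sub [DecidableEq B] (X Y : Matrix (A × M) (A × M) ℂ) :
    (liftAM (X - Y) : Matrix (A × M × B) (A × M × B) ℂ) = liftAM X - liftAM Y := by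
  rw [liftAM, liftAM, liftAM, ← assocOp_sub]
  congr 1
  ext i j
  simp [sub_mul]

theorem liftAM_posSemidef [DecidableEq A] [DecidableEq M] [DecidableEq B]
    {X : Matrix (A × M) (A × M) ℂ} (hX : X.PosSemidef) :
    (liftAM X : Matrix (A × M × B) (A × M × B) ℂ).PosSemidef :=
  assocOp_posSemidef (hX.kronecker Matrix.PosSemidef.one)

theorem liftAM_kronecker_one [DecidableEq M] [DecidableEq B] (Z : Matrix A A ℂ) :
    (liftAM (Z ⊗ₖ (1 : Matrix M M ℂ)) : Matrix (A × M × B) (A × M × B) ℂ) =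
      Z ⊗ₖ (1 : Matrix (M × B) (M × B) ℂ) := by
  rw [liftAM, assocOp, Matrix.kronecker_assoc, Matrix.one_kronecker_one]

theorem liftMB_mul [DecidableEq A] (X Y : Matrix (M × B) (M × B) ℂ) :
    (liftMB (X * Y) : Matrix (A × M × B) (A × M × B) ℂ) = liftMB X * liftMB Y := by
  rw [liftMB, liftMB, liftMB, ← Matrix.mul_kronecker_mul, mul_one]

theorem liftMB_conjTranspose [DecidableEq A] (X : Matrix (M × B) (M × B) ℂ) :
    (liftMB X : Matrix (A × M × B) (A × M × B) ℂ).conjTranspose = liftMB X.conjTranspose := by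
  rw [liftMB, liftMB, Matrix.conjTranspose_kronecker, Matrix.conjTranspose_one]

theorem liftMB_sub [DecidableEq A] (X Y : Matrix (M × B) (M × B) ℂ) :
    (liftMB (X - Y) : Matrix (A × M × B) (A × M × B) ℂ) = liftMB X - liftMB Y := by
  ext i j
  simp [liftMB, mul_sub]

theorem liftMB_posSemidef [DecidableEq A] [DecidableEq M] [DecidableEq B]
    {X : Matrix (M × B) (M × B) ℂ} (hX : X.PosSemidef) :
    (liftMB X : Matrix (A × M × B) (A × M × B) ℂ).PosSemidef :=
  Matrix.PosSemidef.one.kronecker hX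

/-- Regroups the factors so that operations of Alice on `A × M` visibly act on an identity factor.
-/
theorem liftMB_one_kronecker [DecidableEq A] [DecidableEq M] (Z : Matrix B B ℂ) :
    (liftMB ((1 : Matrix M M ℂ) ⊗ₖ Z) : Matrix (A × M × B) (A × M × B) ℂ) =
      assocOp ((1 : Matrix (A × M) (A × M) ℂ) ⊗ₖ Z) := by
  rw [liftMB, assocOp, ← Matrix.one_kronecker_one, Matrix.kronecker_assoc]

/-- The potential depends only on the reduced state, and that is all the semidefinite program
constrains. -/
theorem trace_kronecker_one_mul [DecidableEq M] (Z : Matrix A A ℂ)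
    (ρ : Matrix (A × M) (A × M) ℂ) :
    ((Z ⊗ₖ (1 : Matrix M M ℂ)) * ρ).trace = (Z * traceMRight ρ).trace := by
  simp only [Matrix.trace, Matrix.diag, Matrix.mul_apply, traceMRight, Fintype.sum_prod_type,
    Matrix.kroneckerMap_apply, Matrix.one_apply, mul_ite, mul_one, mul_zero, ite_mul, zero_mul,
    Finset.sum_ite_eq, Finset.mem_univ, if_true, Finset.mul_sum]
  exact Finset.sum_congr rfl fun a _ => Finset.sum_comm

theorem trace_one_kronecker_mul [DecidableEq M] (Z : Matrix B B ℂ)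
    (ρ : Matrix (M × B) (M × B) ℂ) :
    (((1 : Matrix M M ℂ) ⊗ₖ Z) * ρ).trace = (Z * traceMLeft ρ).trace := by
  simp only [Matrix.trace, Matrix.diag, Matrix.mul_apply, traceMLeft, Fintype.sum_prod_type_right,
    Matrix.kroneckerMap_apply, Matrix.one_apply, one_mul, zero_mul, ite_mul,
    Finset.sum_ite_eq, Finset.mem_univ, if_true, Finset.mul_sum]
  exact Finset.sum_congr rfl fun a _ => Finset.sum_comm

theorem ketbra_posSemidef (v : A → ℂ) : (ketbra v).PosSemidef :=
  Matrix.posSemidef_vecMulVec_self_star v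

theorem trace_ketbra (v : A → ℂ) : (ketbra v).trace = (normSq v : ℂ) := by
  rw [ketbra, Matrix.trace_vecMulVec, normSq, dotProduct, Complex.ofReal_sum]
  exact Finset.sum_congr rfl fun x _ => by
    rw [Pi.star_apply, Complex.star_def, Complex.mul_conj']
    push_cast
    rfl

theorem trace_mul_ketbra_of_eigenvector {Z : Matrix A A ℂ} {v : A → ℂ} {c : ℝ}
    (h : Z.mulVec v = (c : ℂ) • v) (hv : normSq v = 1) : (Z * ketbra v).trace = (c : ℂ) := by
  have h1 : Z * ketbra v = (c : ℂ) • ketbra v := by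
    rw [ketbra, Matrix.mul_vecMulVec, h, Matrix.smul_vecMulVec]
  rw [h1, Matrix.trace_smul, trace_ketbra, hv]
  simp

end Tensor

theorem le_zero_of_forall_succ_le {v : ℕ → ℝ} {n : ℕ} (h : ∀ i < n, v (i + 1) ≤ v i) :
    v n ≤ v 0 := by
  induction n with
  | zero => exact le_rfl
  | succ n ih => exact (h n (Nat.lt_succ_self n)).trans (ih fun i hi => h i (by omega))

/-! ### Upper bounds from dual feasible points. -/

namespace Scheme

variable {A M B : Type} [Fintype A] [Fintype M] [Fintype B]
  [DecidableEq A] [DecidableEq M] [DecidableEq B] {P : Scheme A M B} {n : ℕ}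

theorem stateVsBob_posSemidef (P : Scheme A M B) (s : BobStrategy M) (i : ℕ) :
    (P.stateVsBob s i).PosSemidef := by
  induction i with
  | zero =>
    exact (ketbra_posSemidef _).kronecker ((ketbra_posSemidef _).kronecker s.σ_pos)
  | succ i ih =>
    rw [stateVsBob]
    split_ifs
    · exact ih.mul_mul_conjTranspose_same _
    · exact Matrix.posSemidef_sum _ fun k _ => ih.mul_mul_conjTranspose_same _

theorem stateVsAlice_posSemidef (P : Scheme A M B) (s : AliceStrategy M) (i : ℕ) :
    (P.stateVsAlice s i).PosSemidef := by
  induction i with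
  | zero => exact assocOp_posSemidef (s.σ_pos.kronecker (ketbra_posSemidef _))
  | succ i ih =>
    rw [stateVsAlice]
    split_ifs
    · exact Matrix.posSemidef_sum _ fun k _ => ih.mul_mul_conjTranspose_same _
    · exact ih.mul_mul_conjTranspose_same _

/-- The potential `v` starts at `β`, ends at Bob's winning probability and never increases: Alice's
rounds are the dual constraint, and Bob's rounds leave Alice's reduced state alone. -/
theorem cheatB_le_of_dualFeasibleA (hP : P.IsProtocol n) {Z : ℕ → Matrix A A ℂ} {β : ℝ}
    (hZ : P.DualFeasibleA n Z β) : P.cheatB n ≤ (β : EReal) := by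
  refine iSup_le fun s => EReal.coe_le_coe_iff.mpr ?_
  set v : ℕ → ℝ := fun i => ((Z i ⊗ₖ (1 : Matrix (M × Fin s.d) (M × Fin s.d) ℂ)) *
    P.stateVsBob s i).trace.re with hv
  have hstep : ∀ i < n, v (i + 1) ≤ v i := by
    intro i hi
    simp only [hv]
    rcases Nat.even_or_odd (i + 1) with he | ho
    · rw [stateVsBob, if_neg (Nat.not_odd_iff_even.mpr he), ← hZ.even i hi he, Finset.mul_sum,
        Matrix.trace_sum]
      simp_rw [trace_conj_mul]
      rw [← Matrix.trace_sum, ← Finset.sum_mul]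
      -- Bob's Kraus operators commute with `Z i ⊗ 1`, and trace preservation makes them sum to the
      -- identity.
      have h1 : ∑ k, (liftMB (s.K (i + 1) k) : Matrix (A × M × Fin s.d) _ ℂ).conjTranspose *
          (Z i ⊗ₖ (1 : Matrix (M × Fin s.d) (M × Fin s.d) ℂ)) * liftMB (s.K (i + 1) k) =
          Z i ⊗ₖ (1 : Matrix (M × Fin s.d) (M × Fin s.d) ℂ) := by
        conv_rhs => rw [← s.K_tp (i + 1), ← kronecker_sum]
        refine Finset.sum_congr rfl fun k _ => ?_
        rw [liftMB_conjTranspose, liftMB, liftMB, ← Matrix.mul_kronecker_mul,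
          ← Matrix.mul_kronecker_mul, one_mul, mul_one, mul_one]
      rw [h1]
    · rw [stateVsBob, if_pos ho, trace_conj_mul]
      refine Matrix.trace_mul_re_le_of_posSemidef_sub ?_ (P.stateVsBob_posSemidef s i)
      have hE := (hP.EA_proj (i + 1) (by omega) (by omega) ho).isSelfAdjoint.star_eq
      rw [Matrix.star_eq_conjTranspose] at hE
      have := liftAM_posSemidef (B := Fin s.d) (hZ.odd i hi ho)
      rw [liftAM_sub, liftAM_kronecker_one, liftAM_mul, liftAM_mul, liftAM_mul, liftAM_mul,
        liftAM_kronecker_one] at this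
      rw [liftAM_conjTranspose, Matrix.conjTranspose_mul, hE, liftAM_mul, liftAM_mul]
      simpa only [mul_assoc] using this
  have h0 : v 0 = β := by
    simp only [hv]
    rw [stateVsBob, ← Matrix.mul_kronecker_mul, Matrix.trace_kronecker, one_mul,
      Matrix.trace_kronecker, s.σ_trace, trace_ketbra, hP.ψM_unit,
      trace_mul_ketbra_of_eigenvector hZ.eigenvector hP.ψA_unit]
    simp
  have := le_zero_of_forall_succ_le hstep
  rw [h0] at this
  simpa only [hv, hZ.final] using this

theorem cheatA_le_of_dualFeasibleB (hP : P.IsProtocol n) {Z : ℕ → Matrix B B ℂ} {α : ℝ}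
    (hZ : P.DualFeasibleB n Z α) : P.cheatA n ≤ (α : EReal) := by
  refine iSup_le fun s => EReal.coe_le_coe_iff.mpr ?_
  set v : ℕ → ℝ := fun i => ((liftMB ((1 : Matrix M M ℂ) ⊗ₖ Z i) :
    Matrix (Fin s.d × M × B) (Fin s.d × M × B) ℂ) * P.stateVsAlice s i).trace.re with hv
  have hstep : ∀ i < n, v (i + 1) ≤ v i := by
    intro i hi
    simp only [hv]
    rcases Nat.even_or_odd (i + 1) with he | ho
    · rw [stateVsAlice, if_neg (Nat.not_odd_iff_even.mpr he), trace_conj_mul]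
      refine Matrix.trace_mul_re_le_of_posSemidef_sub ?_ (P.stateVsAlice_posSemidef s i)
      have hE := (hP.EB_proj (i + 1) (by omega) (by omega) he).isSelfAdjoint.star_eq
      rw [Matrix.star_eq_conjTranspose] at hE
      have := liftMB_posSemidef (A := Fin s.d) (hZ.even i hi he)
      rw [liftMB_sub, liftMB_mul, liftMB_mul, liftMB_mul, liftMB_mul] at this
      rw [liftMB_conjTranspose, Matrix.conjTranspose_mul, hE, liftMB_mul, liftMB_mul]
      simpa only [mul_assoc] using this
    · rw [stateVsAlice, if_pos ho, ← hZ.odd i hi ho, Finset.mul_sum, Matrix.trace_sum]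
      simp_rw [trace_conj_mul]
      rw [← Matrix.trace_sum, ← Finset.sum_mul]
      have h1 : ∑ k, (liftAM (s.K (i + 1) k) : Matrix (Fin s.d × M × B) _ ℂ).conjTranspose *
          liftMB ((1 : Matrix M M ℂ) ⊗ₖ Z i) * liftAM (s.K (i + 1) k) =
          liftMB ((1 : Matrix M M ℂ) ⊗ₖ Z i) := by
        have h2 : ∑ k, ((s.K (i + 1) k).conjTranspose * s.K (i + 1) k) ⊗ₖ Z i =
            (1 : Matrix (Fin s.d × M) (Fin s.d × M) ℂ) ⊗ₖ Z i := by
          rw [← s.K_tp (i + 1), sum_kronecker]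
        conv_rhs => rw [liftMB_one_kronecker, ← h2, assocOp_sum]
        refine Finset.sum_congr rfl fun k _ => ?_
        rw [liftMB_one_kronecker, liftAM_conjTranspose, liftAM, liftAM, ← assocOp_mul,
          ← assocOp_mul, ← Matrix.mul_kronecker_mul, ← Matrix.mul_kronecker_mul, one_mul, mul_one,
          mul_one]
      rw [h1]
  have h0 : v 0 = α := by
    simp only [hv]
    rw [stateVsAlice, liftMB_one_kronecker, ← assocOp_mul, ← Matrix.mul_kronecker_mul,
      trace_assocOp, Matrix.trace_kronecker, one_mul, s.σ_trace,
      trace_mul_ketbra_of_eigenvector hZ.eigenvector hP.ψB_unit]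
    simp
  have := le_zero_of_forall_succ_le hstep
  rw [h0] at this
  simpa only [hv, hZ.final] using this

/-- The same potential, evaluated on the states of the program instead of those of a strategy. -/
theorem primalValueB_le_of_dualFeasibleA (hP : P.IsProtocol n) {Z : ℕ → Matrix A A ℂ} {β : ℝ}
    (hZ : P.DualFeasibleA n Z β) : P.primalValueB n ≤ (β : EReal) := by
  refine iSup₂_le fun ρ hρ => EReal.coe_le_coe_iff.mpr ?_
  have hstep : ∀ i < n, ((Z (i + 1) ⊗ₖ (1 : Matrix M M ℂ)) * ρ (i + 1)).trace.re ≤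
      ((Z i ⊗ₖ (1 : Matrix M M ℂ)) * ρ i).trace.re := by
    intro i hi
    rw [trace_kronecker_one_mul]
    rcases Nat.even_or_odd (i + 1) with he | ho
    · rw [hρ.even i hi he, ← hZ.even i hi he, trace_kronecker_one_mul]
    · have h := Matrix.trace_mul_re_le_of_posSemidef_sub (hZ.odd i hi ho) (hρ.pos i hi.le)
      rw [hρ.odd i hi ho, ← trace_kronecker_one_mul]
      refine le_of_eq_of_le (congrArg Complex.re ?_) h
      have hE := (hP.EA_proj (i + 1) (by omega) (by omega) ho).isSelfAdjoint.star_eq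
      rw [Matrix.star_eq_conjTranspose] at hE
      have := trace_conj_mul (Z (i + 1) ⊗ₖ (1 : Matrix M M ℂ)) (P.EA (i + 1) * P.UA (i + 1)) (ρ i)
      rw [Matrix.conjTranspose_mul, hE] at this
      simpa only [mul_assoc] using this
  have h0 : ((Z 0 ⊗ₖ (1 : Matrix M M ℂ)) * ρ 0).trace.re = β := by
    rw [trace_kronecker_one_mul, hρ.init,
      trace_mul_ketbra_of_eigenvector hZ.eigenvector hP.ψA_unit, Complex.ofReal_re]
  have := le_zero_of_forall_succ_le
    (v := fun i => ((Z i ⊗ₖ (1 : Matrix M M ℂ)) * ρ i).trace.re) hstep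
  simp only [h0, hZ.final] at this
  exact this

theorem primalValueA_le_of_dualFeasibleB (hP : P.IsProtocol n) {Z : ℕ → Matrix B B ℂ} {α : ℝ}
    (hZ : P.DualFeasibleB n Z α) : P.primalValueA n ≤ (α : EReal) := by
  refine iSup₂_le fun ρ hρ => EReal.coe_le_coe_iff.mpr ?_
  have hstep : ∀ i < n, (((1 : Matrix M M ℂ) ⊗ₖ Z (i + 1)) * ρ (i + 1)).trace.re ≤
      (((1 : Matrix M M ℂ) ⊗ₖ Z i) * ρ i).trace.re := by
    intro i hi
    rw [trace_one_kronecker_mul]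
    rcases Nat.even_or_odd (i + 1) with he | ho
    · have h := Matrix.trace_mul_re_le_of_posSemidef_sub (hZ.even i hi he) (hρ.pos i hi.le)
      rw [hρ.even i hi he, ← trace_one_kronecker_mul]
      refine le_of_eq_of_le (congrArg Complex.re ?_) h
      have hE := (hP.EB_proj (i + 1) (by omega) (by omega) he).isSelfAdjoint.star_eq
      rw [Matrix.star_eq_conjTranspose] at hE
      have := trace_conj_mul ((1 : Matrix M M ℂ) ⊗ₖ Z (i + 1)) (P.EB (i + 1) * P.UB (i + 1)) (ρ i)
      rw [Matrix.conjTranspose_mul, hE] at this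
      simpa only [mul_assoc] using this
    · rw [hρ.odd i hi ho, ← hZ.odd i hi ho, trace_one_kronecker_mul]
  have h0 : (((1 : Matrix M M ℂ) ⊗ₖ Z 0) * ρ 0).trace.re = α := by
    rw [trace_one_kronecker_mul, hρ.init,
      trace_mul_ketbra_of_eigenvector hZ.eigenvector hP.ψB_unit, Complex.ofReal_re]
  have := le_zero_of_forall_succ_le
    (v := fun i => (((1 : Matrix M M ℂ) ⊗ₖ Z i) * ρ i).trace.re) hstep
  simp only [h0, hZ.final] at this
  exact this

end Scheme

/-! ## Lines expressible by matrices -/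

/-- The projection of `ψ` onto the eigenspace of `z` has squared norm `l z`; normalizing it gives `e
z`. One vector per eigenvalue suffices, even in degenerate eigenspaces. -/
theorem exists_eigenvectors_of_prob {d : ℕ} {X : Matrix (Fin d) (Fin d) ℂ} (hX : X.PosSemidef)
    (ψ : EuclideanSpace ℂ (Fin d)) (l : ℝ≥0 → ℝ≥0) (hl : ∀ z, (l z : ℝ) = prob X ψ z)
    (T : Finset ℝ≥0) (hT : ∀ z, l z ≠ 0 → z ∈ T) :
    ∃ e : ℝ≥0 → EuclideanSpace ℂ (Fin d),
      (∀ z, X.toEuclideanLin (e z) = ((z : ℝ) : ℂ) • e z) ∧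
      (∀ z w, z ≠ w → inner ℂ (e z) (e w) = 0) ∧
      (∀ z, l z ≠ 0 → ‖e z‖ = 1) ∧ (∀ z, l z = 0 → e z = 0) ∧
      ∑ z ∈ T, ((√(l z : ℝ) : ℝ) : ℂ) • e z = ψ := by
  have hpos : X.toEuclideanLin.IsPositive := Matrix.isPositive_toEuclideanLin_iff.mpr hX
  have hsymm := hpos.1
  set V : ℝ≥0 → Submodule ℂ (EuclideanSpace ℂ (Fin d)) := fun z =>
    Module.End.eigenspace X.toEuclideanLin ((z : ℝ) : ℂ) with hV
  set g : ℝ≥0 → EuclideanSpace ℂ (Fin d) := fun z => (V z).starProjection ψ with hg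
  have hgV : ∀ z, g z ∈ V z := fun z => Submodule.starProjection_apply_mem _ _
  have hnorm : ∀ z, (l z : ℝ) = ‖g z‖ ^ 2 := by
    intro z
    rw [hl z, prob, ← inner_self_eq_norm_sq (𝕜 := ℂ)]
    have h := Submodule.inner_starProjection_left_eq_right (V z) ψ (g z)
    have h2 : (V z).starProjection (g z) = g z :=
      Submodule.starProjection_eq_self_iff.mpr (hgV z)
    rw [h2] at h
    exact congrArg Complex.re h.symm
  have horth : ∀ z w, z ≠ w → ∀ u ∈ V z, ∀ v ∈ V w, inner ℂ u v = 0 := by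
    intro z w hzw u hu v hv
    have hne : ((z : ℝ) : ℂ) ≠ ((w : ℝ) : ℂ) := by
      intro h
      exact hzw (by exact_mod_cast h)
    exact hsymm.orthogonalFamily_eigenspaces hne ⟨u, hu⟩ ⟨v, hv⟩
  have hzero : ∀ z, l z = 0 → g z = 0 := by
    intro z hz
    have h := hnorm z
    rw [hz] at h
    simpa using h.symm
  have hsum : ∑ z ∈ T, g z = ψ := by
    -- The eigenspaces span, so it is enough that the remainder is orthogonal to each. Eigenvalues
    -- are real and nonnegative, hence indexed by `ℝ≥0`.
    have hmem : ψ - ∑ z ∈ T, g z ∈ (⨆ μ, Module.End.eigenspace X.toEuclideanLin μ)ᗮ := by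
      rw [← Submodule.iInf_orthogonal, Submodule.mem_iInf]
      intro μ
      rw [Submodule.mem_orthogonal]
      intro v hv
      by_cases hv0 : v = 0
      · simp [hv0]
      have hval : Module.End.HasEigenvalue X.toEuclideanLin μ :=
        Module.End.hasEigenvalue_of_hasEigenvector ⟨hv, hv0⟩
      have hreal : ((μ.re : ℝ) : ℂ) = μ :=
        Complex.conj_eq_iff_re.mp (hsymm.conj_eigenvalue_eq_self hval)
      have hnn : 0 ≤ μ.re := by
        have h2 := hpos.2 v
        rw [Module.End.mem_eigenspace_iff.mp hv, ← hreal, inner_smul_left] at h2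
        simp only [Complex.conj_ofReal] at h2
        rw [inner_self_eq_norm_sq_to_K] at h2
        have h4 : ((μ.re : ℂ) * (‖v‖ : ℂ) ^ 2).re = μ.re * ‖v‖ ^ 2 := by
          rw [← Complex.ofReal_pow, ← Complex.ofReal_mul, Complex.ofReal_re]
        have h3 : 0 ≤ μ.re * ‖v‖ ^ 2 := h2.trans_eq h4
        have : 0 < ‖v‖ ^ 2 := by positivity
        nlinarith
      obtain ⟨x, hx⟩ : ∃ x : ℝ≥0, ((x : ℝ) : ℂ) = μ := ⟨⟨μ.re, hnn⟩, hreal⟩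
      have hvx : v ∈ V x := by rw [hV]; simpa [hx] using hv
      have hproj : inner ℂ v ψ = inner ℂ v (g x) := by
        have h := Submodule.inner_starProjection_left_eq_right (V x) v ψ
        rwa [Submodule.starProjection_eq_self_iff.mpr hvx] at h
      rw [inner_sub_right, inner_sum, hproj, sub_eq_zero]
      by_cases hxT : x ∈ T
      · rw [Finset.sum_eq_single_of_mem x hxT]
        intro z _ hz
        exact horth x z hz.symm v hvx _ (hgV z)
      · have : l x = 0 := by
          by_contra h
          exact hxT (hT x h)
        rw [hzero x this, inner_zero_right, Finset.sum_eq_zero]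
        intro z hz
        exact horth x z (fun h => hxT (h ▸ hz)) v hvx _ (hgV z)
    rw [hsymm.orthogonalComplement_iSup_eigenspaces_eq_bot, Submodule.mem_bot, sub_eq_zero] at hmem
    exact hmem.symm
  -- For `l z = 0` the inverse is `0` by convention, which yields the zero vector as wanted.
  refine ⟨fun z => (((√(l z : ℝ) : ℝ) : ℂ))⁻¹ • g z, ?_, ?_, ?_, ?_, ?_⟩
  · intro z
    rw [map_smul, Module.End.mem_eigenspace_iff.mp (hgV z), smul_comm]
  · intro z w hzw
    rw [inner_smul_left, inner_smul_right, horth z w hzw _ (hgV z) _ (hgV w)]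
    simp
  · intro z hz
    have h : ‖g z‖ = √(l z : ℝ) := by rw [hnorm z, Real.sqrt_sq (norm_nonneg _)]
    have h0 : √(l z : ℝ) ≠ 0 :=
      (Real.sqrt_pos.mpr (NNReal.coe_pos.mpr (pos_iff_ne_zero.mpr hz))).ne'
    rw [norm_smul, norm_inv, Complex.norm_real, Real.norm_of_nonneg (Real.sqrt_nonneg _), h,
      inv_mul_cancel₀ h0]
  · intro z hz
    simp [hz]
  · rw [← hsum]
    refine Finset.sum_congr rfl fun z _ => ?_
    by_cases hz : l z = 0
    · simp [hz, hzero z hz]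
    · rw [smul_smul, mul_inv_cancel₀, one_smul]
      exact Complex.ofReal_ne_zero.mpr
        (Real.sqrt_pos.mpr (NNReal.coe_pos.mpr (pos_iff_ne_zero.mpr hz))).ne'

/-! ### Quadratic forms of positive operators along eigenvectors. -/

section Quadratic

variable {E : Type*} [NormedAddCommGroup E] [InnerProductSpace ℂ E] {ι : Type*} [Fintype ι]

/-- A symmetric operator preserves the orthogonal complement of its eigenvectors, so all cross terms
vanish. -/
theorem _root_.LinearMap.IsSymmetric.re_inner_eigenvectors_add {S : E →ₗ[ℂ] E}
    (hS : S.IsSymmetric) {f : ι → E} {μ : ι → ℝ} (hf : ∀ i, S (f i) = (μ i : ℂ) • f i)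
    (ho : Pairwise fun i j => inner ℂ (f i) (f j) = 0) (c : ι → ℂ) {w : E}
    (hw : ∀ i, inner ℂ (f i) w = 0) :
    (inner ℂ (∑ i, c i • f i + w) (S (∑ i, c i • f i + w))).re =
      ∑ i, μ i * (‖c i‖ ^ 2 * ‖f i‖ ^ 2) + (inner ℂ w (S w)).re := by
  have hSw : ∀ i, inner ℂ (f i) (S w) = 0 := by
    intro i
    rw [← hS, hf, inner_smul_left, hw, mul_zero]
  have hw' : ∀ i, inner ℂ w (f i) = 0 := fun i => inner_eq_zero_symm.mp (hw i)
  have hd : ∀ i, inner ℂ (c i • f i) (∑ j, (c j * μ j) • f j) =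
      ((μ i * (‖c i‖ ^ 2 * ‖f i‖ ^ 2) : ℝ) : ℂ) := by
    intro i
    rw [inner_sum, Finset.sum_eq_single i]
    · rw [inner_smul_left, inner_smul_right, inner_self_eq_norm_sq_to_K]
      have := Complex.conj_mul' (c i)
      push_cast
      rw [← this]
      simp only [Complex.coe_algebraMap]
      ring
    · intro j _ hj
      rw [inner_smul_left, inner_smul_right, ho hj.symm]
      simp
    · simp
  have h1 : S (∑ i, c i • f i + w) = ∑ i, (c i * μ i) • f i + S w := by
    simp only [map_add, map_sum, map_smul, hf, smul_smul]
  rw [h1, inner_add_left, inner_add_right, inner_add_right, sum_inner]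
  simp_rw [hd]
  have h2 : inner ℂ (∑ i, c i • f i) (S w) = 0 := by
    simp only [sum_inner, inner_smul_left, hSw, mul_zero, Finset.sum_const_zero]
  have h3 : inner ℂ w (∑ i, (c i * μ i) • f i) = 0 := by
    simp only [inner_sum, inner_smul_right, hw', mul_zero, Finset.sum_const_zero]
  rw [h2, h3, add_zero, zero_add, Complex.add_re, ← Complex.ofReal_sum, Complex.ofReal_re]

/-- A weighted Bessel inequality: the part of `u` orthogonal to the eigenvectors contributes a
nonnegative amount. -/
theorem _root_.LinearMap.IsPositive.sum_eigenvalue_mul_le {S : E →ₗ[ℂ] E} (hS : S.IsPositive)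
    {f : ι → E} {μ : ι → ℝ} (hf : ∀ i, S (f i) = (μ i : ℂ) • f i)
    (ho : Pairwise fun i j => inner ℂ (f i) (f j) = 0) (hn : ∀ i, f i = 0 ∨ ‖f i‖ = 1) (u : E) :
    ∑ i, μ i * ‖inner ℂ (f i) u‖ ^ 2 ≤ (inner ℂ u (S u)).re := by
  have hw : ∀ i, inner ℂ (f i) (u - ∑ j, inner ℂ (f j) u • f j) = 0 := by
    intro i
    rw [inner_sub_right, inner_sum, Finset.sum_eq_single i]
    · rw [inner_smul_right, inner_self_eq_norm_sq_to_K]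
      rcases hn i with h | h <;> simp [h]
    · intro j _ hj
      rw [inner_smul_right, ho hj.symm, mul_zero]
    · simp
  have h := hS.1.re_inner_eigenvectors_add hf ho (fun i => inner ℂ (f i) u) hw
  rw [add_sub_cancel] at h
  rw [h]
  have hnn : 0 ≤ (inner ℂ (u - ∑ j, inner ℂ (f j) u • f j)
      (S (u - ∑ j, inner ℂ (f j) u • f j))).re := by
    rw [← hS.1]
    exact hS.2 _
  refine le_add_of_le_of_nonneg (Finset.sum_le_sum fun i _ => le_of_eq ?_) hnn
  rcases hn i with h | h <;> simp [h]

theorem re_inner_le_opNorm [FiniteDimensional ℂ E] (S : E →ₗ[ℂ] E) (t : E) :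
    (inner ℂ t (S t)).re ≤ ‖LinearMap.toContinuousLinearMap S‖ * ‖t‖ ^ 2 := by
  have h1 : (inner ℂ t (S t)).re ≤ ‖t‖ * ‖S t‖ :=
    re_inner_le_norm (𝕜 := ℂ) t (S t)
  have h2 : ‖S t‖ ≤ ‖LinearMap.toContinuousLinearMap S‖ * ‖t‖ :=
    (LinearMap.toContinuousLinearMap S).le_opNorm t
  calc (inner ℂ t (S t)).re ≤ ‖t‖ * ‖S t‖ := h1
    _ ≤ ‖t‖ * (‖LinearMap.toContinuousLinearMap S‖ * ‖t‖) := by gcongr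
    _ = _ := by ring

/-- If `X ⪯ Y`, the eigenvectors `e` of `X` and `f` of `Y` compare the spectral quadratic forms. -/
theorem sum_eigenvalue_mul_le_of_le [FiniteDimensional ℂ E] {X Y : E →ₗ[ℂ] E}
    (hX : X.IsPositive) (hY : Y.IsPositive) (hXY : (Y - X).IsPositive) {e f : ι → E} {μ : ι → ℝ}
    (hμ : ∀ i, 0 ≤ μ i)
    (he : ∀ i, X (e i) = (μ i : ℂ) • e i) (hf : ∀ i, Y (f i) = (μ i : ℂ) • f i)
    (heo : Pairwise fun i j => inner ℂ (e i) (e j) = 0) (hen : ∀ i, e i = 0 ∨ ‖e i‖ = 1)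
    (hfo : Pairwise fun i j => inner ℂ (f i) (f j) = 0) (hfn : ∀ i, f i = 0 ∨ ‖f i‖ = 1)
    (c : ι → ℂ) {t : E} (ht : ∀ i, inner ℂ (f i) t = 0) :
    ∑ i, μ i * ‖inner ℂ (e i) (∑ i, c i • f i + t)‖ ^ 2 ≤
      ∑ i, μ i * ‖c i‖ ^ 2 + ‖LinearMap.toContinuousLinearMap Y‖ * ‖t‖ ^ 2 := by
  -- With `u = ∑ c i • f i + t`, the chain is: spectral sum of `X` at most `⟨u, X u⟩`, at most `⟨u,
  -- Y u⟩`. The last splits along `f` and `t`, and on `t` only the norm of `Y` is used.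
  have h1 := hX.sum_eigenvalue_mul_le he heo hen (∑ i, c i • f i + t)
  have h2 := hXY.2 (∑ i, c i • f i + t)
  rw [hXY.1, LinearMap.sub_apply, inner_sub_right, map_sub] at h2
  have h3 := hY.1.re_inner_eigenvectors_add hf hfo c ht
  have h4 : ∑ i, μ i * (‖c i‖ ^ 2 * ‖f i‖ ^ 2) ≤ ∑ i, μ i * ‖c i‖ ^ 2 := by
    refine Finset.sum_le_sum fun i _ => mul_le_mul_of_nonneg_left ?_ (hμ i)
    rcases hfn i with h | h <;> simp [h]
  have h5 := re_inner_le_opNorm Y t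
  simp only [RCLike.re_to_complex] at h2
  linarith

end Quadratic

/-- A unitary `U` maps the amplitudes `√r` to `√l` and, after projection onto the support of `l`,
does not increase the quadratic form of `diag z`. -/
structure IsLineStep {L : Type*} [Fintype L] [DecidableEq L] (z : L → ℝ) (l r : L → ℝ≥0)
    (U : Matrix L L ℂ) : Prop where
  unitary : U ∈ Matrix.unitaryGroup L ℂ
  map : U.mulVec (fun a => ((√(r a : ℝ) : ℝ) : ℂ)) = fun a => ((√(l a : ℝ) : ℝ) : ℂ)
  le : ∀ w : L → ℂ,
    ∑ a, (if l a = 0 then 0 else z a * ‖U.mulVec w a‖ ^ 2) ≤ ∑ a, z a * ‖w a‖ ^ 2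

/-- Serves the lines at extra labels and the idle steps after the end of the game. -/
theorem IsLineStep.refl {L : Type*} [Fintype L] [DecidableEq L] {z : L → ℝ} (hz : ∀ a, 0 ≤ z a)
    (l : L → ℝ≥0) : IsLineStep z l l (1 : Matrix L L ℂ) where
  unitary := one_mem _
  map := by simp
  le w := by
    refine Finset.sum_le_sum fun a _ => ?_
    have := mul_nonneg (hz a) (sq_nonneg ‖w a‖)
    rw [Matrix.one_mulVec]
    split_ifs
    · exact this
    · exact le_rfl

/-- Basis labels of a party: the coordinates in `T`, and `D` further labels. -/
abbrev Label (T : Finset ℝ≥0) (D : ℕ) : Type := T ⊕ Fin D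

/-- The dual value of a label; the further labels have the large value `D`. -/
def Label.value {T : Finset ℝ≥0} {D : ℕ} : Label T D → ℝ :=
  Sum.elim (fun x => ((x : ℝ≥0) : ℝ)) (fun _ => (D : ℝ))

/-- A function on a line as a function on labels. -/
def onLabels {T : Finset ℝ≥0} {D : ℕ} (l : ℝ≥0 → ℝ≥0) : Label T D → ℝ≥0 :=
  Sum.elim (fun x => l x) (fun _ => 0)

theorem exists_linearIsometry_euclideanSpace {d D : ℕ} (h : d ≤ D) :
    Nonempty (EuclideanSpace ℂ (Fin d) →ₗᵢ[ℂ] EuclideanSpace ℂ (Fin D)) := by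
  let b := EuclideanSpace.basisFun (Fin d) ℂ
  let f := b.toBasis.constr ℂ fun i => EuclideanSpace.single (Fin.castLE h i) (1 : ℂ)
  refine ⟨f.isometryOfOrthonormal (v := b.toBasis) (by simp) ?_⟩
  have : f ∘ b.toBasis = (EuclideanSpace.basisFun (Fin D) ℂ) ∘ Fin.castLE h := by
    funext i
    simp [f]
  rw [this]
  exact (EuclideanSpace.basisFun (Fin D) ℂ).orthonormal.comp _ (Fin.castLE_injective h)

/-- Coordinates with respect to an orthogonal family `f` of vectors of norm at most one, followed by
the coordinates of the part orthogonal to `f`. -/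
theorem exists_isometry_to_labels {d D : ℕ} (h : d ≤ D) {T : Finset ℝ≥0}
    {f : T → EuclideanSpace ℂ (Fin d)}
    (ho : Pairwise fun i j => inner ℂ (f i) (f j) = 0) (hn : ∀ i, f i = 0 ∨ ‖f i‖ = 1) :
    ∃ (J : EuclideanSpace ℂ (Fin d) → EuclideanSpace ℂ (Label T D))
      (G : EuclideanSpace ℂ (Label T D) → EuclideanSpace ℂ (Fin d)),
      (∀ u v, inner ℂ (J u) (J v) = inner ℂ u v) ∧
      (∀ v w, inner ℂ (J v) w = inner ℂ v (G w)) ∧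
      (∀ c : T → ℂ, J (∑ x, c x • f x) =
        WithLp.toLp 2 (Sum.elim (fun x => c x * (‖f x‖ : ℂ) ^ 2) fun _ => 0)) ∧
      (∀ w, ∃ s, G w = ∑ x, w (Sum.inl x) • f x + s ∧ (∀ x, inner ℂ (f x) s = 0) ∧
        ‖s‖ ^ 2 ≤ ∑ j, ‖w (Sum.inr j)‖ ^ 2) := by
  obtain ⟨ι⟩ := exists_linearIsometry_euclideanSpace h
  -- `P` projects onto the orthogonal complement of the `f x`, and `R` keeps the extra labels. `J`
  -- below pairs the coefficients along `f` with `ι ∘ P`, and `G` is its adjoint.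
  let P : EuclideanSpace ℂ (Fin d) → EuclideanSpace ℂ (Fin d) :=
    fun v => v - ∑ x, inner ℂ (f x) v • f x
  let R : EuclideanSpace ℂ (Label T D) → EuclideanSpace ℂ (Fin D) :=
    fun w => WithLp.toLp 2 fun j => w (Sum.inr j)
  have hff : ∀ (c : T → ℂ) x, inner ℂ (f x) (∑ y, c y • f y) = c x * (‖f x‖ : ℂ) ^ 2 := by
    intro c x
    rw [inner_sum, Finset.sum_eq_single x]
    · rw [inner_smul_right, inner_self_eq_norm_sq_to_K]; rfl
    · intro y _ hy
      rw [inner_smul_right, ho hy.symm, mul_zero]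
    · simp
  have hfP : ∀ v x, inner ℂ (f x) (P v) = 0 := by
    intro v x
    simp only [P]
    rw [inner_sub_right, hff]
    rcases hn x with h0 | h1
    · simp [h0]
    · simp [h1]
  have hPP : ∀ u v, inner ℂ (P u) (P v) = inner ℂ u (P v) := by
    intro u v
    conv_lhs => rw [show P u = u - ∑ x, inner ℂ (f x) u • f x from rfl]
    rw [inner_sub_left, sum_inner]
    simp only [inner_smul_left, hfP, mul_zero, Finset.sum_const_zero, sub_zero]
  have hPsymm : ∀ u v, inner ℂ (P u) v = inner ℂ u (P v) := by
    intro u v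
    rw [← hPP u v, ← inner_conj_symm, ← inner_conj_symm (P u) (P v), hPP v u]
  refine ⟨fun v => WithLp.toLp 2 (Sum.elim (fun x => inner ℂ (f x) v) fun j => ι (P v) j),
    fun w => ∑ x, w (Sum.inl x) • f x + P (LinearMap.adjoint ι.toLinearMap (R w)), ?_, ?_, ?_, ?_⟩
  · intro u v
    have h1 : inner ℂ (ι (P u)) (ι (P v)) = inner ℂ u (P v) := by rw [ι.inner_map_map, hPP]
    rw [PiLp.inner_apply] at h1
    rw [PiLp.inner_apply, Fintype.sum_sum_type]
    simp only [Sum.elim_inl, Sum.elim_inr]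
    rw [h1]
    simp only [P, inner_sub_right, inner_sum, inner_smul_right]
    rw [add_sub_left_comm, ← Finset.sum_sub_distrib, Finset.sum_eq_zero, add_zero]
    intro x _
    rw [RCLike.inner_apply, inner_conj_symm, sub_self]
  · intro v w
    have h1 : inner ℂ (ι (P v)) (R w) =
        inner ℂ v (P (LinearMap.adjoint ι.toLinearMap (R w))) := by
      rw [← hPsymm, LinearMap.adjoint_inner_right]; rfl
    rw [PiLp.inner_apply] at h1
    rw [PiLp.inner_apply, Fintype.sum_sum_type, inner_add_right, ← h1, inner_sum]
    simp only [Sum.elim_inl, Sum.elim_inr]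
    congr 1
    refine Finset.sum_congr rfl fun x _ => ?_
    rw [RCLike.inner_apply, inner_conj_symm, inner_smul_right]
  · intro c
    have hP0 : P (∑ x, c x • f x) = 0 := by
      simp only [P, hff]
      rw [← Finset.sum_sub_distrib, Finset.sum_eq_zero]
      intro x _
      rcases hn x with h0 | h1
      · simp [h0]
      · simp [h1]
    simp only [hff, hP0, map_zero]
    rfl
  · intro w
    refine ⟨_, rfl, hfP _, ?_⟩
    set t := LinearMap.adjoint ι.toLinearMap (R w)
    have h1 : ‖P t‖ ≤ ‖t‖ := by
      have h2 : ‖P t‖ ^ 2 ≤ ‖t‖ * ‖P t‖ := by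
        rw [← inner_self_eq_norm_sq (𝕜 := ℂ), hPP]
        exact re_inner_le_norm _ _
      by_cases h0 : ‖P t‖ = 0
      · rw [h0]; positivity
      · have : 0 < ‖P t‖ := lt_of_le_of_ne (norm_nonneg _) (Ne.symm h0)
        nlinarith
    have h2 : ‖t‖ ≤ ‖R w‖ := by
      have h3 : ‖t‖ ^ 2 ≤ ‖R w‖ * ‖t‖ := by
        rw [← inner_self_eq_norm_sq (𝕜 := ℂ)]
        rw [show inner ℂ t t = inner ℂ (R w) (ι t) from LinearMap.adjoint_inner_left _ _ _]
        exact (re_inner_le_norm _ _).trans (by rw [ι.norm_map])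
      by_cases h0 : ‖t‖ = 0
      · rw [h0]; positivity
      · have : 0 < ‖t‖ := lt_of_le_of_ne (norm_nonneg _) (Ne.symm h0)
        nlinarith
    have h3 : ‖R w‖ ^ 2 = ∑ j, ‖w (Sum.inr j)‖ ^ 2 := EuclideanSpace.norm_sq_eq _
    rw [← h3]
    exact pow_le_pow_left₀ (norm_nonneg _) (h1.trans h2) 2

/-- Stated for all large `D`, so that finitely many lines can share one label space. The bound `d ≤
D` gives room for the complement of `f`, and `‖Y‖ ≤ D` lets the value of the extra labels absorb the
remainder. -/
theorem EBMLine.eventually_isLineStep {l r : ℝ≥0 → ℝ≥0} (hlr : EBMLine l r) {T : Finset ℝ≥0}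
    (hl : ∀ z, l z ≠ 0 → z ∈ T) (hr : ∀ z, r z ≠ 0 → z ∈ T) :
    ∀ᶠ D : ℕ in Filter.atTop, ∃ U : Matrix (Label T D) (Label T D) ℂ,
      IsLineStep Label.value (onLabels l) (onLabels r) U := by
  obtain ⟨d, X, Y, ψ, hX, hXY, hlX, hrY⟩ := hlr
  have hY : Y.PosSemidef := by simpa using hXY.add hX
  obtain ⟨e, heX, heo, he1, he0, heψ⟩ := exists_eigenvectors_of_prob hX ψ l hlX T hl
  obtain ⟨f, hfY, hfo, hf1, hf0, hfψ⟩ := exists_eigenvectors_of_prob hY ψ r hrY T hr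
  have hXs := (Matrix.isPositive_toEuclideanLin_iff.mpr hX)
  have hYs := (Matrix.isPositive_toEuclideanLin_iff.mpr hY)
  have hXYs : (Y.toEuclideanLin - X.toEuclideanLin).IsPositive := by
    rw [← map_sub]
    exact Matrix.isPositive_toEuclideanLin_iff.mpr hXY
  filter_upwards [Filter.eventually_ge_atTop d, tendsto_natCast_atTop_atTop.eventually_ge_atTop
    ‖LinearMap.toContinuousLinearMap Y.toEuclideanLin‖] with D hdD hK
  have hfo' : Pairwise fun i j : T => inner ℂ (f i) (f j) = 0 :=
    fun i j hij => hfo i j (fun h => hij (Subtype.ext h))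
  have heo' : Pairwise fun i j : T => inner ℂ (e i) (e j) = 0 :=
    fun i j hij => heo i j (fun h => hij (Subtype.ext h))
  have hfn : ∀ i : T, f i = 0 ∨ ‖f i‖ = 1 := fun i =>
    (em (r i = 0)).imp (hf0 i) (hf1 i)
  have hen : ∀ i : T, e i = 0 ∨ ‖e i‖ = 1 := fun i =>
    (em (l i = 0)).imp (he0 i) (he1 i)
  obtain ⟨J, G, hJ, hJG, hJf, hG⟩ := exists_isometry_to_labels hdD hfo' hfn
  -- These are the prescribed rows of `U` on the support of `l`. The completion to a basis is
  -- arbitrary elsewhere: there the amplitude `√l` is zero and the quadratic form is not counted.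
  let v : Label T D → EuclideanSpace ℂ (Label T D) := Sum.elim (fun x => J (e x)) fun _ => 0
  let s : Set (Label T D) := {a | onLabels l a ≠ 0}
  have hs : ∀ a ∈ s, ∃ x : T, a = Sum.inl x ∧ l x ≠ 0 := by
    rintro (x | j) ha
    · exact ⟨x, rfl, ha⟩
    · exact absurd rfl ha
  have hv : Orthonormal ℂ (s.domRestrict v) := by
    constructor
    · rintro ⟨a, ha⟩
      obtain ⟨x, rfl, hx⟩ := hs a ha
      have : ‖J (e x)‖ ^ 2 = 1 := by
        rw [← inner_self_eq_norm_sq (𝕜 := ℂ), hJ, inner_self_eq_norm_sq, he1 x hx, one_pow]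
      exact (pow_eq_one_iff_of_nonneg (norm_nonneg _) two_ne_zero).mp this
    · rintro ⟨a, ha⟩ ⟨b, hb⟩ hab
      obtain ⟨x, rfl, hx⟩ := hs a ha
      obtain ⟨y, rfl, hy⟩ := hs b hb
      refine (hJ (e x) (e y)).trans (heo' fun h => hab ?_)
      subst h; rfl
  obtain ⟨b, hb⟩ := hv.exists_orthonormalBasis_extension_of_card_eq (by simp)
  let U : Matrix (Label T D) (Label T D) ℂ := Matrix.of fun a a' => star (b a a')
  have hU : ∀ w a, U.mulVec w a = inner ℂ (b a) (WithLp.toLp 2 w) := by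
    intro w a
    rw [PiLp.inner_apply]
    simp only [RCLike.inner_apply, Matrix.mulVec, dotProduct, U, Matrix.of_apply]
    exact Finset.sum_congr rfl fun _ _ => mul_comm _ _
  have hψ : WithLp.toLp 2 (fun a => ((√(onLabels r a : ℝ) : ℝ) : ℂ)) = J ψ := by
    rw [← hfψ, ← Finset.sum_coe_sort, hJf]
    congr 1
    funext a
    rcases a with x | j
    · by_cases hx : r x = 0
      · simp [onLabels, hx]
      · simp [onLabels, hf1 x hx]
    · simp [onLabels]
  refine ⟨U, ?_, ?_, ?_⟩
  · rw [Matrix.mem_unitaryGroup_iff]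
    ext a a'
    have h1 := orthonormal_iff_ite.mp b.orthonormal a a'
    rw [PiLp.inner_apply] at h1
    rw [Matrix.mul_apply, Matrix.one_apply, ← h1]
    simp only [RCLike.inner_apply, Matrix.star_apply, U, Matrix.of_apply, star_star]
    exact Finset.sum_congr rfl fun _ _ => mul_comm _ _
  · funext a
    rw [hU, hψ]
    -- `J` is only known through inner products, so the expansion of `ψ` is transported by testing
    -- against every `w` and moving `J` to `G`.
    have h1 : J ψ = ∑ x : T, ((√(l x : ℝ) : ℝ) : ℂ) • b (Sum.inl x) := by
      refine ext_inner_left ℂ fun w => ?_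
      rw [← inner_conj_symm, hJG, inner_conj_symm, ← heψ, ← Finset.sum_coe_sort, inner_sum,
        inner_sum]
      refine Finset.sum_congr rfl fun x _ => ?_
      by_cases hx : l x = 0
      · simp [hx]
      · rw [inner_smul_right, inner_smul_right, hb (Sum.inl x) hx, ← inner_conj_symm w]
        simp only [v, Sum.elim_inl]
        rw [hJG, inner_conj_symm]
    rw [h1, inner_sum]
    simp only [inner_smul_right, orthonormal_iff_ite.mp b.orthonormal]
    rcases a with x | j
    · simp [onLabels]
    · simp [onLabels]
  · intro w
    obtain ⟨t, hGw, hft, ht⟩ := hG (WithLp.toLp 2 w)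
    have hmain := sum_eigenvalue_mul_le_of_le hXs hYs hXYs (μ := fun x : T => ((x : ℝ≥0) : ℝ))
      (fun x => x.1.2) (fun x => heX x) (fun x => hfY x) heo' hen hfo' hfn
      (fun x => w (Sum.inl x)) hft
    have hGw' : G (WithLp.toLp 2 w) = ∑ x : T, w (Sum.inl x) • f x + t := hGw
    rw [← hGw'] at hmain
    have hR : ‖LinearMap.toContinuousLinearMap Y.toEuclideanLin‖ * ‖t‖ ^ 2 ≤
        ∑ j : Fin D, (D : ℝ) * ‖w (Sum.inr j)‖ ^ 2 := by
      rw [← Finset.mul_sum]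
      exact mul_le_mul hK ht (sq_nonneg _) (Nat.cast_nonneg _)
    rw [Fintype.sum_sum_type, Fintype.sum_sum_type]
    refine le_trans ?_ (hmain.trans (add_le_add_right hR _))
    have hr0 : ∑ j : Fin D, (if onLabels l (Sum.inr j : Label T D) = 0 then 0 else
        Label.value (Sum.inr j : Label T D) * ‖U.mulVec w (Sum.inr j)‖ ^ 2) = 0 :=
      Finset.sum_eq_zero fun j _ => if_pos rfl
    rw [hr0, add_zero]
    refine Finset.sum_le_sum fun x _ => ?_
    split_ifs with hx
    · exact mul_nonneg x.1.2 (sq_nonneg _)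
    · rw [hU, hb (Sum.inl x) hx, ← hJG]
      exact le_rfl

/-! ## Controlled unitaries and consistency checks -/

section Gadget

variable {L : Type} [Fintype L] [DecidableEq L]

/-- On basis states `|a⟩|m, c⟩`, exchanges `|o⟩` and `|a⟩` in the register of `m`. -/
def swapCopy (o : L) : L × L × L ≃ L × L × L where
  toFun x := (x.1, Equiv.swap o x.1 x.2.1, x.2.2)
  invFun x := (x.1, Equiv.swap o x.1 x.2.1, x.2.2)
  left_inv x := by simp
  right_inv x := by simp

/-- Erases the copy of `a` in `|a⟩|a, c⟩`, applies `V c` to the first register, and makes a new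
copy. -/
def controlled (o : L) (V : L → Matrix L L ℂ) : Matrix (L × L × L) (L × L × L) ℂ :=
  (Matrix.blockDiagonal fun m : L × L => V m.2).submatrix (swapCopy o) (swapCopy o)

/-- Projection onto the basis states `|a⟩|a, c⟩` with `q a c ≠ 0`. -/
noncomputable def supportCheck (q : L → L → ℝ≥0) : Matrix (L × L × L) (L × L × L) ℂ :=
  Matrix.diagonal fun x => if x.2.1 = x.1 ∧ q x.1 x.2.2 ≠ 0 then 1 else 0

theorem controlled_mem_unitaryGroup (o : L) {V : L → Matrix L L ℂ}
    (hV : ∀ c, V c ∈ Matrix.unitaryGroup L ℂ) :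
    controlled o V ∈ Matrix.unitaryGroup (L × L × L) ℂ := by
  rw [Matrix.mem_unitaryGroup_iff, Matrix.star_eq_conjTranspose, controlled,
    Matrix.conjTranspose_submatrix, Matrix.submatrix_mul_equiv, Matrix.blockDiagonal_conjTranspose,
    ← Matrix.blockDiagonal_mul]
  have h : (fun m : L × L => V m.2 * (V m.2).conjTranspose) = 1 := by
    funext m
    exact Matrix.mem_unitaryGroup_iff.mp (hV m.2)
  rw [h, Matrix.blockDiagonal_one, Matrix.submatrix_one_equiv]

theorem controlled_mulVec_apply (o : L) (V : L → Matrix L L ℂ) (v : L × L × L → ℂ) (a m c : L) :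
    (controlled o V).mulVec v (a, m, c) =
      ∑ a', V c a a' * v (a', Equiv.swap o a' (Equiv.swap o a m), c) := by
  rw [controlled, Matrix.submatrix_mulVec_equiv, Function.comp_apply, Matrix.mulVec, dotProduct,
    Fintype.sum_prod_type]
  refine Finset.sum_congr rfl fun a' _ => ?_
  rw [Finset.sum_eq_single (Equiv.swap o a m, c)]
  · simp [swapCopy, Matrix.blockDiagonal_apply]
  · intro y _ hy
    rw [swapCopy, Equiv.coe_fn_mk, Matrix.blockDiagonal_apply_ne _ _ _ hy.symm, zero_mul]
  · simp

theorem controlled_mulVec_self (o : L) (V : L → Matrix L L ℂ) (v : L × L × L → ℂ) (a c : L) :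
    (controlled o V).mulVec v (a, a, c) = (V c).mulVec (fun a' => v (a', a', c)) a := by
  rw [controlled_mulVec_apply]
  simp [Matrix.mulVec, dotProduct]

/-- The swap turns a correct copy `|a⟩|a⟩` into the blank `|a⟩|o⟩`, which no longer depends on `a`.
Hence `V c` acts coherently, and the second swap restores correct copies. -/
theorem controlled_mulVec_copy (o : L) (V : L → Matrix L L ℂ) (u : L → L → ℂ) :
    (controlled o V).mulVec (fun y => if y.2.1 = y.1 then u y.1 y.2.2 else 0) =
      fun y => if y.2.1 = y.1 then (V y.2.2).mulVec (fun a => u a y.2.2) y.1 else 0 := by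
  funext ⟨a, m, c⟩
  by_cases h : m = a
  · subst h
    rw [controlled_mulVec_self]
    simp
  · rw [controlled_mulVec_apply, if_neg h, Finset.sum_eq_zero]
    intro a' _
    rw [if_neg, mul_zero]
    intro h'
    -- A correct copy becomes the blank `o` when erased, and only `m = a` arises from the blank when
    -- copied again.
    have h1 : Equiv.swap o a m = o := by
      have := congrArg (Equiv.swap o a') h'
      simpa using this
    have h2 := congrArg (Equiv.swap o a) h1
    exact h (by simpa using h2)

theorem isStarProjection_supportCheck (q : L → L → ℝ≥0) : IsStarProjection (supportCheck q) := by
  constructor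
  · rw [IsIdempotentElem, supportCheck, Matrix.diagonal_mul_diagonal]
    congr 1
    funext x
    split_ifs <;> simp
  · rw [IsSelfAdjoint, Matrix.star_eq_conjTranspose, supportCheck, Matrix.diagonal_conjTranspose]
    congr 1
    funext x
    simp only [Pi.star_apply]
    split_ifs <;> simp

theorem _root_.Matrix.posSemidef_diagonal_sub {n : Type*} [Fintype n] [DecidableEq n] {w d : n → ℝ}
    {C : Matrix n n ℂ} (h : ∀ v : n → ℂ, ∑ i, d i * ‖C.mulVec v i‖ ^ 2 ≤ ∑ i, w i * ‖v i‖ ^ 2) :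
    (Matrix.diagonal (fun i => (w i : ℂ)) -
      C.conjTranspose * Matrix.diagonal (fun i => (d i : ℂ)) * C).PosSemidef := by
  have hdiag : ∀ (w : n → ℝ), (Matrix.diagonal fun i => (w i : ℂ)).IsHermitian := fun w =>
    Matrix.isHermitian_diagonal_of_self_adjoint _ (by
      rw [IsSelfAdjoint]; funext i; simp)
  have hquad : ∀ (w : n → ℝ) (v : n → ℂ),
      star v ⬝ᵥ (Matrix.diagonal fun i => (w i : ℂ)).mulVec v =
        ((∑ i, w i * ‖v i‖ ^ 2 : ℝ) : ℂ) := by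
    intro w v
    rw [dotProduct, Complex.ofReal_sum]
    refine Finset.sum_congr rfl fun i _ => ?_
    rw [Matrix.mulVec_diagonal, Pi.star_apply, Complex.star_def, mul_left_comm, Complex.conj_mul']
    push_cast
    rfl
  refine Matrix.PosSemidef.of_dotProduct_mulVec_nonneg ?_ fun v => ?_
  · exact (hdiag w).sub (Matrix.isHermitian_conjTranspose_mul_mul C (hdiag d))
  · rw [Matrix.sub_mulVec, dotProduct_sub, hquad, ← Matrix.mulVec_mulVec, ← Matrix.mulVec_mulVec,
      Matrix.dotProduct_mulVec, ← Matrix.star_mulVec, hquad, ← Complex.ofReal_sub]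
    exact_mod_cast sub_nonneg.mpr (h v)

/-- After the check only correct copies count, and their amplitudes depend only on correct copies
with the same control `c`. The constraint thus splits into one inequality per line. A separate `z'`
allows the diagonal to change in the last round. -/
theorem posSemidef_kronecker_sub_controlled (o : L) {V : L → Matrix L L ℂ} {q : L → L → ℝ≥0}
    {z z' : L → ℝ} (hz : ∀ a, 0 ≤ z a)
    (h : ∀ c (w : L → ℂ), ∑ a, (if q a c = 0 then 0 else z' a * ‖(V c).mulVec w a‖ ^ 2) ≤
      ∑ a, z a * ‖w a‖ ^ 2) :
    ((Matrix.diagonal fun a => (z a : ℂ)) ⊗ₖ (1 : Matrix (L × L) (L × L) ℂ) -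
      (controlled o V).conjTranspose * supportCheck q *
        ((Matrix.diagonal fun a => (z' a : ℂ)) ⊗ₖ (1 : Matrix (L × L) (L × L) ℂ)) *
          supportCheck q * controlled o V).PosSemidef := by
  have h1 : ∀ z : L → ℝ, (Matrix.diagonal fun a => (z a : ℂ)) ⊗ₖ (1 : Matrix (L × L) (L × L) ℂ) =
      Matrix.diagonal fun x : L × L × L => ((z x.1 : ℝ) : ℂ) := by
    intro z
    rw [← Matrix.diagonal_one, Matrix.diagonal_kronecker_diagonal]
    simp
  have h2 : supportCheck q * (Matrix.diagonal fun x : L × L × L => ((z' x.1 : ℝ) : ℂ)) *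
      supportCheck q = Matrix.diagonal fun x : L × L × L =>
        ((if x.2.1 = x.1 ∧ q x.1 x.2.2 ≠ 0 then z' x.1 else 0 : ℝ) : ℂ) := by
    rw [supportCheck, Matrix.diagonal_mul_diagonal, Matrix.diagonal_mul_diagonal]
    congr 1
    funext x
    split_ifs <;> simp
  rw [h1, h1, mul_assoc (controlled o V).conjTranspose, mul_assoc (controlled o V).conjTranspose,
    h2]
  refine Matrix.posSemidef_diagonal_sub fun v => ?_
  have h3 : ∀ g : L × L × L → ℝ, ∑ x, g x = ∑ c, ∑ a, ∑ m, g (a, m, c) := by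
    intro g
    rw [Fintype.sum_prod_type]
    simp_rw [Fintype.sum_prod_type_right]
    exact Finset.sum_comm
  rw [h3, h3]
  refine Finset.sum_le_sum fun c _ => ?_
  calc _ = ∑ a, (if q a c = 0 then 0 else
        z' a * ‖(V c).mulVec (fun a' => v (a', a', c)) a‖ ^ 2) := by
        refine Finset.sum_congr rfl fun a _ => ?_
        rw [Finset.sum_eq_single a]
        · rw [controlled_mulVec_self]
          by_cases hq : q a c = 0 <;> simp [hq]
        · intro m _ hm
          simp [hm]
        · simp
    _ ≤ ∑ a, z a * ‖v (a, a, c)‖ ^ 2 := h c _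
    -- Incorrect copies `m ≠ a` are added back; their weights are nonnegative.
    _ ≤ _ := by
        refine Finset.sum_le_sum fun a _ => ?_
        exact Finset.single_le_sum (f := fun m => z a * ‖v (a, m, c)‖ ^ 2)
          (fun m _ => mul_nonneg (hz a) (sq_nonneg _)) (Finset.mem_univ a)

/-- Exchange of the roles of the two parties. -/
def mirror : (L × L) × L ≃ L × L × L where
  toFun x := (x.2, x.1.2, x.1.1)
  invFun x := ((x.2.2, x.2.1), x.1)
  left_inv _ := rfl
  right_inv _ := rfl

/-- Transfers the dual constraint from Alice's ordering of the registers to Bob's. -/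
theorem one_kronecker_eq_submatrix_mirror (Z : Matrix L L ℂ) :
    (1 : Matrix (L × L) (L × L) ℂ) ⊗ₖ Z =
      (Z ⊗ₖ (1 : Matrix (L × L) (L × L) ℂ)).submatrix mirror mirror := by
  ext ⟨⟨a, b⟩, c⟩ ⟨⟨a', b'⟩, c'⟩
  simp [mirror, Matrix.one_apply, and_comm, mul_comm]

theorem isStarProjection_submatrix {m n : Type*} [Fintype m] [Fintype n] (e : m ≃ n)
    {X : Matrix n n ℂ} (hX : IsStarProjection X) : IsStarProjection (X.submatrix e e) := by
  constructor
  · rw [IsIdempotentElem, Matrix.submatrix_mul_equiv, hX.isIdempotentElem.eq]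
  · have := hX.isSelfAdjoint.star_eq
    rw [Matrix.star_eq_conjTranspose] at this
    rw [IsSelfAdjoint, Matrix.star_eq_conjTranspose, Matrix.conjTranspose_submatrix, this]

theorem submatrix_mem_unitaryGroup {m n : Type*} [Fintype m] [Fintype n] [DecidableEq m]
    [DecidableEq n] (e : m ≃ n) {X : Matrix n n ℂ} (hX : X ∈ Matrix.unitaryGroup n ℂ) :
    X.submatrix e e ∈ Matrix.unitaryGroup m ℂ := by
  rw [Matrix.mem_unitaryGroup_iff, Matrix.star_eq_conjTranspose] at hX ⊢
  rw [Matrix.conjTranspose_submatrix, Matrix.submatrix_mul_equiv, hX, Matrix.submatrix_one_equiv]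

end Gadget

/-! ### Action of one party's operators on the global state. -/

section Lift

variable {A M B : Type} [Fintype A] [Fintype M] [Fintype B] [DecidableEq A] [DecidableEq B]

theorem liftAM_mulVec_apply (X : Matrix (A × M) (A × M) ℂ) (v : A × M × B → ℂ) (a : A) (m : M)
    (b : B) : (liftAM X).mulVec v (a, m, b) = X.mulVec (fun y => v (y.1, y.2, b)) (a, m) := by
  simp only [liftAM, assocOp, Matrix.mulVec, dotProduct, Matrix.reindex_apply,
    Matrix.submatrix_apply, Fintype.sum_prod_type, Matrix.kroneckerMap_apply, Matrix.one_apply,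
    Equiv.prodAssoc_symm_apply]
  simp

theorem liftMB_mulVec_apply (X : Matrix (M × B) (M × B) ℂ) (v : A × M × B → ℂ) (a : A) (m : M)
    (b : B) : (liftMB X).mulVec v (a, m, b) = X.mulVec (fun y => v (a, y.1, y.2)) (m, b) := by
  simp only [liftMB, Matrix.mulVec, dotProduct, Fintype.sum_prod_type, Matrix.kroneckerMap_apply,
    Matrix.one_apply]
  rw [Finset.sum_eq_single a]
  · simp
  · intro a' _ h
    simp [h.symm]
  · simp

end Lift

/-! ## The protocol of a point game on labels -/

/-- A point game `q 0, …, q N` on pairs of labels with dual values `z`, whose steps are carried out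
by unitaries `V k`, controlled by the label of the other party. -/
structure IsLabelGame {L : Type} [Fintype L] [DecidableEq L] (N : ℕ) (z : L → ℝ)
    (q : ℕ → L → L → ℝ≥0) (V : ℕ → L → Matrix L L ℂ) (zero one a₀ b₀ : L) : Prop where
  even : Even N
  pos : 0 < N
  z_nonneg : ∀ a, 0 ≤ z a
  z_one : z one = 1
  z_zero : z zero = 0
  vertical : ∀ k < N, Even k → ∀ a, IsLineStep z (q k a) (q (k + 1) a) (V k a)
  horizontal : ∀ k < N, Odd k → ∀ b,
    IsLineStep z (fun a => q k a b) (fun a => q (k + 1) a b) (V k b)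
  init : ∀ a b, q 0 a b = if a = zero ∧ b = one ∨ a = one ∧ b = zero then 1 / 2 else 0
  final : ∀ a b, q N a b = if a = a₀ ∧ b = b₀ then 1 else 0

section Protocol

variable {L : Type} [Fintype L] [DecidableEq L]

/-- The protocol that runs a point game on labels backwards. -/
noncomputable def gameScheme (N : ℕ) (q : ℕ → L → L → ℝ≥0) (V : ℕ → L → Matrix L L ℂ)
    (one a₀ b₀ : L) : Scheme L (L × L) L where
  ψA := Pi.single a₀ 1
  ψM := Pi.single (a₀, b₀) 1
  ψB := Pi.single b₀ 1
  -- Message `i` undoes game step `N - i`, leading from `q (N - i + 1)` to `q (N - i)`. The choice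
  -- of blank symbol is immaterial.
  UA i := controlled a₀ (V (N - i))
  UB i := (controlled b₀ (V (N - i))).submatrix mirror mirror
  EA i := supportCheck (q (N - i))
  EB i := (supportCheck fun b a => q (N - i) a b).submatrix mirror mirror
  -- A party holding the label `one` declares the other the winner: `[0,1]` is a win for Alice and
  -- `[1,0]` a win for Bob.
  povmA := ![Matrix.diagonal fun a => if a = one then 0 else 1,
    Matrix.diagonal fun a => if a = one then 1 else 0]
  povmB := ![Matrix.diagonal fun b => if b = one then 1 else 0,
    Matrix.diagonal fun b => if b = one then 0 else 1]

/-- The honest state `∑ √q(a, b) |a⟩|a, b⟩|b⟩`. -/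
noncomputable def gameState (q : L → L → ℝ≥0) : L × (L × L) × L → ℂ :=
  fun x => if x.2.1.1 = x.1 ∧ x.2.1.2 = x.2.2 then ((√(q x.1 x.2.2 : ℝ) : ℝ) : ℂ) else 0

/-- For each fixed label `b` of Bob the state consists of correct copies with control `b`, so `V b`
acts on exactly the line of height `b`. -/
theorem liftAM_controlled_mulVec_gameState {z : L → ℝ} {q q' : L → L → ℝ≥0} {V : L → Matrix L L ℂ}
    (o : L) (h : ∀ b, IsLineStep z (fun a => q a b) (fun a => q' a b) (V b)) :
    (liftAM (controlled o V)).mulVec (gameState q') = gameState q := by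
  funext ⟨a, ⟨m, c⟩, b⟩
  rw [liftAM_mulVec_apply]
  have h1 : (fun y : L × L × L => gameState q' (y.1, y.2, b)) = fun y => if y.2.1 = y.1 then
      (fun a c => if c = b then ((√(q' a b : ℝ) : ℝ) : ℂ) else 0) y.1 y.2.2 else 0 := by
    funext y
    simp only [gameState, ite_and]
  refine (congrArg (fun v => (controlled o V).mulVec v (a, m, c)) h1).trans
    ((congrFun (controlled_mulVec_copy o V fun a c =>
      if c = b then ((√(q' a b : ℝ) : ℝ) : ℂ) else 0)
      (a, m, c)).trans ?_)
  simp only [gameState, ite_and]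
  by_cases hc : c = b
  · subst hc
    simp only [if_true, (h c).map]
  · simp only [if_neg hc, ite_self, ite_eq_right_iff]
    intro _
    exact congrFun (Matrix.mulVec_zero (V c)) a

theorem liftMB_controlled_mulVec_gameState {z : L → ℝ} {q q' : L → L → ℝ≥0} {V : L → Matrix L L ℂ}
    (o : L) (h : ∀ a, IsLineStep z (q a) (q' a) (V a)) :
    (liftMB ((controlled o V).submatrix mirror mirror)).mulVec (gameState q') = gameState q := by
  funext ⟨a, ⟨c, m⟩, b⟩
  rw [liftMB_mulVec_apply, Matrix.submatrix_mulVec_equiv, Function.comp_apply]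
  have h1 : ((fun y : (L × L) × L => gameState q' (a, y.1, y.2)) ∘ mirror.symm) =
      fun y => if y.2.1 = y.1 then
      (fun b c => if c = a then ((√(q' a b : ℝ) : ℝ) : ℂ) else 0) y.1 y.2.2 else 0 := by
    funext y
    simp only [gameState, mirror, Function.comp_apply, Equiv.coe_fn_symm_mk]
    simp only [and_comm (a := y.2.2 = a), ite_and]
  refine (congrArg (fun v => (controlled o V).mulVec v (b, m, c)) h1).trans
    ((congrFun (controlled_mulVec_copy o V fun b c =>
      if c = a then ((√(q' a b : ℝ) : ℝ) : ℂ) else 0)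
      (b, m, c)).trans ?_)
  simp only [gameState, and_comm (a := c = a), ite_and]
  by_cases hc : c = a
  · subst hc
    simp only [if_true, (h c).map]
  · simp only [if_neg hc, ite_self, ite_eq_right_iff]
    intro _
    exact congrFun (Matrix.mulVec_zero (V c)) b

theorem liftAM_supportCheck_mulVec_gameState (q : L → L → ℝ≥0) :
    (liftAM (supportCheck q)).mulVec (gameState q) = gameState q := by
  funext ⟨a, ⟨m, c⟩, b⟩
  rw [liftAM_mulVec_apply, supportCheck, Matrix.mulVec_diagonal]
  simp only [gameState]
  by_cases h : m = a ∧ c = b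
  · obtain ⟨rfl, rfl⟩ := h
    by_cases hq : q m c = 0 <;> simp [hq]
  · simp [h]

theorem liftMB_supportCheck_mulVec_gameState (q : L → L → ℝ≥0) :
    (liftMB ((supportCheck fun b a => q a b).submatrix mirror mirror)).mulVec (gameState q) =
      gameState q := by
  funext ⟨a, ⟨c, m⟩, b⟩
  rw [liftMB_mulVec_apply, Matrix.submatrix_mulVec_equiv, Function.comp_apply, supportCheck,
    Matrix.mulVec_diagonal]
  simp only [gameState, mirror, Equiv.coe_fn_mk, Function.comp_apply, Equiv.coe_fn_symm_mk]
  by_cases h : c = a ∧ m = b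
  · obtain ⟨rfl, rfl⟩ := h
    by_cases hq : q c m = 0 <;> simp [hq]
  · simp [h]

theorem normSq_single {A : Type} [Fintype A] [DecidableEq A] (a : A) :
    normSq (Pi.single a (1 : ℂ) : A → ℂ) = 1 := by
  rw [normSq, Finset.sum_eq_single a]
  · simp
  · intro b _ hb
    simp [hb]
  · simp

variable {N : ℕ} {z : L → ℝ} {q : ℕ → L → L → ℝ≥0} {V : ℕ → L → Matrix L L ℂ}
  {zero one a₀ b₀ : L}

namespace IsLabelGame

theorem zero_ne_one (h : IsLabelGame N z q V zero one a₀ b₀) : zero ≠ one := by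
  intro he
  have h1 := h.z_one
  rw [← he, h.z_zero] at h1
  exact _root_.zero_ne_one h1

theorem honest_gameScheme (h : IsLabelGame N z q V zero one a₀ b₀) (i : ℕ) (hi : i ≤ N) :
    (gameScheme N q V one a₀ b₀).honest i = gameState (q (N - i)) := by
  induction i with
  | zero =>
    funext ⟨a, ⟨m, c⟩, b⟩
    simp only [Scheme.honest, gameScheme, gameState, Nat.sub_zero, h.final, Pi.single_apply,
      Prod.mk.injEq]
    by_cases ha : a = a₀
    · by_cases hb : b = b₀
      · subst ha hb
        simp
      · simp [hb]
    · simp [ha]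
  | succ i ih =>
    rw [Scheme.honest, ih (by omega), Scheme.U]
    -- As `N` is even, `N - (i + 1)` and `i + 1` have equal parity: Alice performs the horizontal
    -- steps and Bob the vertical ones.
    have hN : N - i = N - (i + 1) + 1 := by omega
    rw [hN]
    split_ifs with ho
    · exact liftAM_controlled_mulVec_gameState _
        (h.horizontal _ (by omega) (Nat.Even.sub_odd hi h.even ho))
    · exact liftMB_controlled_mulVec_gameState _
        (h.vertical _ (by omega)
          ((Nat.even_sub hi).mpr (iff_of_true h.even (Nat.not_odd_iff_even.mp ho))))

theorem outcome_mulVec_honest (h : IsLabelGame N z q V zero one a₀ b₀) (i j : Fin 2) {f g : L → ℂ}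
    (hf : (gameScheme N q V one a₀ b₀).povmA i = Matrix.diagonal f)
    (hg : (gameScheme N q V one a₀ b₀).povmB j = Matrix.diagonal g) :
    ((gameScheme N q V one a₀ b₀).outcome i j).mulVec ((gameScheme N q V one a₀ b₀).honest N) =
      fun x => f x.1 * g x.2.2 * gameState (q 0) x := by
  funext x
  rw [h.honest_gameScheme N le_rfl, Nat.sub_self, Scheme.outcome, hf, hg, ← Matrix.diagonal_one,
    Matrix.diagonal_kronecker_diagonal, Matrix.diagonal_kronecker_diagonal, Matrix.mulVec_diagonal,
    one_mul]

theorem normSq_gameState_init (h : IsLabelGame N z q V zero one a₀ b₀) (a b : L)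
    (hab : a = zero ∧ b = one ∨ a = one ∧ b = zero) {f : L × (L × L) × L → ℂ}
    (hf : ∀ x, f x * gameState (q 0) x ≠ 0 → x = (a, (a, b), b)) (hf1 : f (a, (a, b), b) = 1) :
    normSq (fun x => f x * gameState (q 0) x) = 1 / 2 := by
  rw [normSq, Finset.sum_eq_single (a, (a, b), b)]
  · simp only [hf1, gameState, and_self, if_true, h.init, if_pos hab, one_mul, Complex.norm_real,
      Real.norm_eq_abs, sq_abs]
    rw [Real.sq_sqrt] <;> norm_num
  · intro x _ hx
    by_contra hne
    refine hx (hf x fun h0 => hne ?_)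
    rw [h0]
    simp
  · simp

theorem eq_of_gameState_init_ne_zero (h : IsLabelGame N z q V zero one a₀ b₀)
    {x : L × (L × L) × L} (hx : gameState (q 0) x ≠ 0) :
    x = (zero, (zero, one), one) ∨ x = (one, (one, zero), zero) := by
  obtain ⟨a, ⟨m, c⟩, b⟩ := x
  simp only [gameState, h.init] at hx
  by_cases h1 : m = a ∧ c = b
  · obtain ⟨rfl, rfl⟩ := h1
    by_cases h2 : m = zero ∧ c = one ∨ m = one ∧ c = zero
    · rcases h2 with ⟨rfl, rfl⟩ | ⟨rfl, rfl⟩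
      · exact Or.inl rfl
      · exact Or.inr rfl
    · simp [h2] at hx
  · simp [h1] at hx

theorem isProtocol (h : IsLabelGame N z q V zero one a₀ b₀) :
    (gameScheme N q V one a₀ b₀).IsProtocol N where
  even := h.even
  ψA_unit := normSq_single _
  ψM_unit := normSq_single _
  ψB_unit := normSq_single _
  UA_unitary i h1 hi ho := controlled_mem_unitaryGroup _ fun c =>
    (h.horizontal (N - i) (by omega) (Nat.Even.sub_odd hi h.even ho) c).unitary
  UB_unitary i h1 hi he := submatrix_mem_unitaryGroup _ <| controlled_mem_unitaryGroup _ fun c =>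
    (h.vertical (N - i) (by omega) ((Nat.even_sub hi).mpr (iff_of_true h.even he)) c).unitary
  EA_proj _ _ _ _ := isStarProjection_supportCheck _
  EB_proj _ _ _ _ := isStarProjection_submatrix _ (isStarProjection_supportCheck _)
  E_honest i h1 hi := by
    rw [h.honest_gameScheme i hi, Scheme.E]
    split_ifs
    · exact liftAM_supportCheck_mulVec_gameState _
    · exact liftMB_supportCheck_mulVec_gameState _
  povmA_pos := by
    refine Fin.forall_fin_two.mpr ⟨Matrix.PosSemidef.diagonal fun a => ?_,
      Matrix.PosSemidef.diagonal fun a => ?_⟩ <;> simp only [Pi.zero_apply] <;> split_ifs <;> simp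
  povmA_sum := by
    change Matrix.diagonal _ + Matrix.diagonal _ = 1
    rw [Matrix.diagonal_add, ← Matrix.diagonal_one]
    congr 1
    funext a
    split_ifs <;> simp
  povmB_pos := by
    refine Fin.forall_fin_two.mpr ⟨Matrix.PosSemidef.diagonal fun a => ?_,
      Matrix.PosSemidef.diagonal fun a => ?_⟩ <;> simp only [Pi.zero_apply] <;> split_ifs <;> simp
  povmB_sum := by
    change Matrix.diagonal _ + Matrix.diagonal _ = 1
    rw [Matrix.diagonal_add, ← Matrix.diagonal_one]
    congr 1
    funext a
    split_ifs <;> simp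
  correct01 := by
    rw [h.outcome_mulVec_honest 0 1 rfl rfl]
    funext x
    by_contra hx
    rcases h.eq_of_gameState_init_ne_zero (right_ne_zero_of_mul hx) with rfl | rfl <;>
      simp at hx
  correct10 := by
    rw [h.outcome_mulVec_honest 1 0 rfl rfl]
    funext x
    by_contra hx
    rcases h.eq_of_gameState_init_ne_zero (right_ne_zero_of_mul hx) with rfl | rfl <;>
      simp [h.zero_ne_one] at hx
  balanced_A := by
    rw [h.outcome_mulVec_honest 0 0 rfl rfl]
    refine h.normSq_gameState_init zero one (Or.inl ⟨rfl, rfl⟩) (fun x hx => ?_) ?_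
    · rcases h.eq_of_gameState_init_ne_zero (right_ne_zero_of_mul hx) with rfl | rfl
      · rfl
      · simp at hx
    · simp [h.zero_ne_one]
  balanced_B := by
    rw [h.outcome_mulVec_honest 1 1 rfl rfl]
    refine h.normSq_gameState_init one zero (Or.inr ⟨rfl, rfl⟩) (fun x hx => ?_) ?_
    · rcases h.eq_of_gameState_init_ne_zero (right_ne_zero_of_mul hx) with rfl | rfl
      · simp at hx
      · rfl
    · simp [h.zero_ne_one]

end IsLabelGame

/-- The dual values at step `i`: `z` before step `k`, the indicator of `one` from step `k` on. -/
noncomputable def dualValue (z : L → ℝ) (one : L) (k i : ℕ) : L → ℝ :=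
  if i < k then z else fun a => if a = one then 1 else 0

/-! ### Dual feasible points of the protocol. -/

namespace IsLabelGame

theorem dualValue_nonneg (h : IsLabelGame N z q V zero one a₀ b₀) (k i : ℕ) (a : L) :
    0 ≤ dualValue z one k i a := by
  unfold dualValue
  split_ifs
  · exact h.z_nonneg a
  · positivity

/-- Since `z one = 1` and `z ≥ 0`, the projector of the final measurement lies below the diagonal of
`z`, so the switch costs nothing. -/
theorem dualValue_le (h : IsLabelGame N z q V zero one a₀ b₀) (k i : ℕ) (a : L) :
    dualValue z one k i a ≤ z a := by
  unfold dualValue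
  split_ifs with h1
  · exact le_rfl
  · dsimp only
    split_ifs with h2
    · rw [h2, h.z_one]
    · exact h.z_nonneg a

theorem sum_dualValue_le (h : IsLabelGame N z q V zero one a₀ b₀) (k i : ℕ) {l r : L → ℝ≥0}
    {U : Matrix L L ℂ} (hU : IsLineStep z l r U) (w : L → ℂ) :
    ∑ a, (if l a = 0 then 0 else dualValue z one k i a * ‖U.mulVec w a‖ ^ 2) ≤
      ∑ a, z a * ‖w a‖ ^ 2 := by
  refine le_trans (Finset.sum_le_sum fun a _ => ?_) (hU.le w)
  split_ifs
  · exact le_rfl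
  · exact mul_le_mul_of_nonneg_right (h.dualValue_le k i a) (sq_nonneg _)

/-- The switch is at `N - 1`, Alice's last message. It cannot fall on one of Bob's rounds, by
parity, so the equality constraints hold. -/
theorem dualFeasibleA (h : IsLabelGame N z q V zero one a₀ b₀) (ha : 0 < z a₀) :
    (gameScheme N q V one a₀ b₀).DualFeasibleA N
      (fun i => Matrix.diagonal fun a => (dualValue z one (N - 1) i a : ℂ)) (z a₀) where
  pos i _ := Matrix.PosSemidef.diagonal fun a =>
    Complex.zero_le_real.mpr (h.dualValue_nonneg _ _ a)
  odd i hi ho := by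
    have hz : dualValue z one (N - 1) i = z := by
      have := h.even
      rw [dualValue, if_pos]
      grind
    rw [hz]
    exact posSemidef_kronecker_sub_controlled _ h.z_nonneg fun c w =>
      h.sum_dualValue_le _ _ (h.horizontal _ (by omega) (Nat.Even.sub_odd hi h.even ho) c) w
  even i hi he := by
    have : (i < N - 1) ↔ (i + 1 < N - 1) := by
      have := h.even
      grind
    simp only [dualValue, this]
  final := by
    change _ = Matrix.diagonal _
    congr 1
    funext a
    rw [dualValue, if_neg (by omega)]
    split_ifs <;> simp
  eigenvalue_pos := ha
  eigenvector := by
    have hz : dualValue z one (N - 1) 0 = z := by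
      have := h.even
      have := h.pos
      rw [dualValue, if_pos]
      grind
    rw [hz]
    change (Matrix.diagonal _).mulVec (Pi.single a₀ 1) = _ • Pi.single a₀ 1
    funext a
    rw [Matrix.mulVec_diagonal, Pi.smul_apply, smul_eq_mul]
    by_cases h1 : a = a₀
    · rw [h1]
    · simp [h1]

/-- Bob sends the last message, so his switch is at `N`. -/
theorem dualFeasibleB (h : IsLabelGame N z q V zero one a₀ b₀) (hb : 0 < z b₀) :
    (gameScheme N q V one a₀ b₀).DualFeasibleB N
      (fun i => Matrix.diagonal fun a => (dualValue z one N i a : ℂ)) (z b₀) where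
  pos i _ := Matrix.PosSemidef.diagonal fun a =>
    Complex.zero_le_real.mpr (h.dualValue_nonneg _ _ a)
  even i hi he := by
    have hz : dualValue z one N i = z := by
      rw [dualValue, if_pos hi]
    rw [hz]
    have := posSemidef_kronecker_sub_controlled b₀ (q := fun b a => q (N - (i + 1)) a b)
      h.z_nonneg fun c w =>
      h.sum_dualValue_le N (i + 1)
        (h.vertical (N - (i + 1)) (by omega) ((Nat.even_sub hi).mpr (iff_of_true h.even he)) c) w
    convert this.submatrix (mirror : (L × L) × L ≃ L × L × L) using 1
    simp only [gameScheme, one_kronecker_eq_submatrix_mirror, Matrix.conjTranspose_submatrix,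
      Matrix.submatrix_mul_equiv]
    rfl
  odd i hi ho := by
    have : (i < N) ↔ (i + 1 < N) := by
      have := h.even
      grind
    simp only [dualValue, this]
  final := by
    change _ = Matrix.diagonal _
    congr 1
    funext a
    rw [dualValue, if_neg (by omega)]
    split_ifs <;> simp
  eigenvalue_pos := hb
  eigenvector := by
    have hz : dualValue z one N 0 = z := by
      rw [dualValue, if_pos h.pos]
    rw [hz]
    change (Matrix.diagonal _).mulVec (Pi.single b₀ 1) = _ • Pi.single b₀ 1
    funext a
    rw [Matrix.mulVec_diagonal, Pi.smul_apply, smul_eq_mul]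
    by_cases h1 : a = b₀
    · rw [h1]
    · simp [h1]

end IsLabelGame

end Protocol

/-! ## The final point of a point game -/

section FinalPoint

variable {L : Type} [Fintype L] [DecidableEq L]

theorem norm_sqrt_sq (x : ℝ≥0) : ‖((√(x : ℝ) : ℝ) : ℂ)‖ ^ 2 = x := by
  rw [Complex.norm_real, Real.norm_eq_abs, sq_abs, Real.sq_sqrt x.coe_nonneg]

/-- The quadratic inequality at the amplitude vector `√r`. -/
theorem IsLineStep.sum_value_le {z : L → ℝ} {l r : L → ℝ≥0} {U : Matrix L L ℂ}
    (h : IsLineStep z l r U) : ∑ a, z a * (l a : ℝ) ≤ ∑ a, z a * (r a : ℝ) := by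
  have h1 := h.le fun a => ((√(r a : ℝ) : ℝ) : ℂ)
  rw [h.map] at h1
  simp only [norm_sqrt_sq] at h1
  refine le_of_eq_of_le (Finset.sum_congr rfl fun a _ => ?_) h1
  split_ifs with h0
  · simp [h0]
  · rfl

theorem IsLineStep.sum_eq {z : L → ℝ} {l r : L → ℝ≥0} {U : Matrix L L ℂ}
    (h : IsLineStep z l r U) : ∑ a, (l a : ℝ) = ∑ a, (r a : ℝ) := by
  have hdot : ∀ l : L → ℝ≥0, star (fun a => ((√(l a : ℝ) : ℝ) : ℂ)) ⬝ᵥ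
      (fun a => ((√(l a : ℝ) : ℝ) : ℂ)) = ((∑ a, (l a : ℝ) : ℝ) : ℂ) := by
    intro l
    rw [dotProduct, Complex.ofReal_sum]
    refine Finset.sum_congr rfl fun a _ => ?_
    rw [Pi.star_apply, Complex.star_def, Complex.conj_mul']
    exact_mod_cast norm_sqrt_sq (l a)
  have h1 : U.conjTranspose * U = 1 := Matrix.mem_unitaryGroup_iff'.mp h.unitary
  apply Complex.ofReal_injective
  rw [← hdot, ← hdot, ← h.map, Matrix.star_mulVec, ← Matrix.dotProduct_mulVec,
    Matrix.mulVec_mulVec, h1, Matrix.one_mulVec]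

variable {N : ℕ} {z : L → ℝ} {q : ℕ → L → L → ℝ≥0} {V : ℕ → L → Matrix L L ℂ}
  {zero one a₀ b₀ : L}

/-- The mean first coordinate is at least `1/2` at the start. Vertical steps preserve the mass of
each column, horizontal steps do not lower the mean, and at the end it is `z a₀`. -/
theorem IsLabelGame.value_fst_pos (h : IsLabelGame N z q V zero one a₀ b₀) : 0 < z a₀ := by
  have hstep : ∀ k < N, ∑ a, ∑ b, z a * (q k a b : ℝ) ≤ ∑ a, ∑ b, z a * (q (k + 1) a b : ℝ) := by
    intro k hk
    rcases Nat.even_or_odd k with he | ho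
    · refine le_of_eq (Finset.sum_congr rfl fun a _ => ?_)
      rw [← Finset.mul_sum, ← Finset.mul_sum, (h.vertical k hk he a).sum_eq]
    · rw [Finset.sum_comm]
      conv_rhs => rw [Finset.sum_comm]
      exact Finset.sum_le_sum fun b _ => (h.horizontal k hk ho b).sum_value_le
  have hle := le_zero_of_forall_succ_le (v := fun k => -∑ a, ∑ b, z a * (q k a b : ℝ))
    fun k hk => neg_le_neg (hstep k hk)
  have h0 : (1 / 2 : ℝ) ≤ ∑ a, ∑ b, z a * (q 0 a b : ℝ) := by
    have hnn : ∀ a b, 0 ≤ z a * (q 0 a b : ℝ) := fun a b =>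
      mul_nonneg (h.z_nonneg a) (q 0 a b).coe_nonneg
    refine le_trans ?_ (Finset.single_le_sum (fun a _ => Finset.sum_nonneg fun b _ => hnn a b)
      (Finset.mem_univ one))
    refine le_trans ?_ (Finset.single_le_sum (fun b _ => hnn one b) (Finset.mem_univ zero))
    rw [h.init, h.z_one, if_pos (Or.inr ⟨rfl, rfl⟩)]
    norm_num
  have hN : ∑ a, ∑ b, z a * (q N a b : ℝ) = z a₀ := by
    simp [h.final, ite_and, apply_ite NNReal.toReal]
  simp only [hN] at hle
  linarith

theorem IsLabelGame.value_snd_pos (h : IsLabelGame N z q V zero one a₀ b₀) : 0 < z b₀ := by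
  have hstep : ∀ k < N, ∑ b, ∑ a, z b * (q k a b : ℝ) ≤ ∑ b, ∑ a, z b * (q (k + 1) a b : ℝ) := by
    intro k hk
    rcases Nat.even_or_odd k with he | ho
    · rw [Finset.sum_comm]
      conv_rhs => rw [Finset.sum_comm]
      exact Finset.sum_le_sum fun a _ => (h.vertical k hk he a).sum_value_le
    · refine le_of_eq (Finset.sum_congr rfl fun b _ => ?_)
      rw [← Finset.mul_sum, ← Finset.mul_sum, (h.horizontal k hk ho b).sum_eq]
  have hle := le_zero_of_forall_succ_le (v := fun k => -∑ b, ∑ a, z b * (q k a b : ℝ))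
    fun k hk => neg_le_neg (hstep k hk)
  have h0 : (1 / 2 : ℝ) ≤ ∑ b, ∑ a, z b * (q 0 a b : ℝ) := by
    have hnn : ∀ a b, 0 ≤ z b * (q 0 a b : ℝ) := fun a b =>
      mul_nonneg (h.z_nonneg b) (q 0 a b).coe_nonneg
    refine le_trans ?_ (Finset.single_le_sum (fun b _ => Finset.sum_nonneg fun a _ => hnn a b)
      (Finset.mem_univ one))
    refine le_trans ?_ (Finset.single_le_sum (fun a _ => hnn a one) (Finset.mem_univ zero))
    rw [h.init, h.z_one, if_pos (Or.inl ⟨rfl, rfl⟩)]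
    norm_num
  have hN : ∑ b, ∑ a, z b * (q N a b : ℝ) = z b₀ := by
    simp [h.final, ite_and, apply_ite NNReal.toReal]
  simp only [hN] at hle
  linarith

end FinalPoint

/-! ## From point games to label games -/

/-- All coordinates of points in the supports of `p 0, …, p n`. -/
noncomputable def coordinates (n : ℕ) (p : ℕ → (ℝ≥0 × ℝ≥0 →₀ ℝ≥0)) : Finset ℝ≥0 :=
  (Finset.range (n + 1)).biUnion fun i =>
    (p i).support.image Prod.fst ∪ (p i).support.image Prod.snd

theorem mem_coordinates {n : ℕ} {p : ℕ → (ℝ≥0 × ℝ≥0 →₀ ℝ≥0)} {i : ℕ} (hi : i ≤ n) {x y : ℝ≥0}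
    (h : p i (x, y) ≠ 0) : x ∈ coordinates n p ∧ y ∈ coordinates n p := by
  have hmem : (x, y) ∈ (p i).support := Finsupp.mem_support_iff.mpr h
  have hr : i ∈ Finset.range (n + 1) := Finset.mem_range.mpr (by omega)
  exact ⟨Finset.mem_biUnion.mpr ⟨i, hr, Finset.mem_union_left _ (Finset.mem_image_of_mem _ hmem)⟩,
    Finset.mem_biUnion.mpr ⟨i, hr, Finset.mem_union_right _ (Finset.mem_image_of_mem _ hmem)⟩⟩

/-- A function on the plane as a function on pairs of labels. -/
def onLabelPairs {T : Finset ℝ≥0} {D : ℕ} (p : ℝ≥0 × ℝ≥0 → ℝ≥0) (a b : Label T D) : ℝ≥0 :=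
  onLabels (fun x => onLabels (fun y => p (x, y)) b) a

theorem onLabelPairs_inr_right {T : Finset ℝ≥0} {D : ℕ} (p : ℝ≥0 × ℝ≥0 → ℝ≥0) (j : Fin D)
    (a : Label T D) : onLabelPairs p a (Sum.inr j) = 0 := by
  rcases a with x | i <;> rfl

theorem Label.value_nonneg {T : Finset ℝ≥0} {D : ℕ} (a : Label T D) : 0 ≤ a.value := by
  rcases a with x | j
  · exact x.1.coe_nonneg
  · exact Nat.cast_nonneg D

theorem IsEBMPointGame.exists_isLabelGame {n : ℕ} {p : ℕ → (ℝ≥0 × ℝ≥0 →₀ ℝ≥0)} {β α : ℝ≥0}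
    (hp : IsEBMPointGame n p β α) :
    ∃ (T : Finset ℝ≥0) (D N : ℕ) (q : ℕ → Label T D → Label T D → ℝ≥0)
      (V : ℕ → Label T D → Matrix (Label T D) (Label T D) ℂ) (zero one a₀ b₀ : Label T D),
      IsLabelGame N Label.value q V zero one a₀ b₀ ∧ a₀.value = β ∧ b₀.value = α := by
  set T := coordinates n p with hT
  -- Only finitely many lines occur, so a single `D` serves them all.
  have hev : ∀ᶠ D : ℕ in Filter.atTop, ∀ k ∈ Finset.range n, ∀ t ∈ T,
      (Even k → ∃ U : Matrix (Label T D) (Label T D) ℂ, IsLineStep Label.value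
        (onLabels fun y => p k (t, y)) (onLabels fun y => p (k + 1) (t, y)) U) ∧
      (Odd k → ∃ U : Matrix (Label T D) (Label T D) ℂ, IsLineStep Label.value
        (onLabels fun x => p k (x, t)) (onLabels fun x => p (k + 1) (x, t)) U) := by
    rw [Filter.eventually_all_finset]
    intro k hk
    rw [Filter.eventually_all_finset]
    intro t _
    rw [Finset.mem_range] at hk
    refine Filter.Eventually.and ?_ ?_
    · rw [Filter.eventually_imp_distrib_left]
      intro he
      exact (hp.vertical k hk he t).eventually_isLineStep
        (fun _ h => (mem_coordinates (by omega) h).2) (fun _ h => (mem_coordinates (by omega) h).2)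
    · rw [Filter.eventually_imp_distrib_left]
      intro ho
      exact (hp.horizontal k hk ho t).eventually_isLineStep
        (fun _ h => (mem_coordinates (by omega) h).1) (fun _ h => (mem_coordinates (by omega) h).1)
  obtain ⟨D, hD⟩ := hev.exists
  -- After step `n` the game idles at its final point.
  let q : ℕ → Label T D → Label T D → ℝ≥0 := fun k => onLabelPairs (p (min k n))
  have hV : ∀ k (c : Label T D), ∃ U : Matrix (Label T D) (Label T D) ℂ,
      (Even k → IsLineStep Label.value (q k c) (q (k + 1) c) U) ∧
      (Odd k → IsLineStep Label.value (fun a => q k a c) (fun a => q (k + 1) a c) U) := by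
    intro k c
    by_cases hk : k < n
    · have h1 : q k = onLabelPairs (p k) := by simp only [q, min_eq_left hk.le]
      have h2 : q (k + 1) = onLabelPairs (p (k + 1)) := by
        simp only [q, min_eq_left (Nat.succ_le_of_lt hk)]
      rw [h1, h2]
      rcases c with t | j
      · obtain ⟨hE, hO⟩ := hD k (Finset.mem_range.mpr hk) t t.2
        rcases Nat.even_or_odd k with he | ho
        · obtain ⟨U, hU⟩ := hE he
          exact ⟨U, fun _ => hU, fun ho => absurd he (Nat.not_even_iff_odd.mpr ho)⟩
        · obtain ⟨U, hU⟩ := hO ho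
          exact ⟨U, fun he => absurd he (Nat.not_even_iff_odd.mpr ho), fun _ => hU⟩
      · refine ⟨1, fun _ => IsLineStep.refl Label.value_nonneg _, fun _ => ?_⟩
        simp only [onLabelPairs_inr_right]
        exact IsLineStep.refl Label.value_nonneg _
    · have h1 : q (k + 1) = q k := by
        simp only [q, min_eq_right (not_lt.mp hk), min_eq_right (Nat.le_succ_of_le (not_lt.mp hk))]
      rw [h1]
      exact ⟨1, fun _ => IsLineStep.refl Label.value_nonneg _,
        fun _ => IsLineStep.refl Label.value_nonneg _⟩
  choose V hVE hVO using hV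
  have h01 : p 0 (0, 1) ≠ 0 := by
    rw [hp.init]
    simp
  have hfin : p n (β, α) ≠ 0 := by
    rw [hp.final]
    simp
  obtain ⟨m0, m1⟩ := mem_coordinates (Nat.zero_le n) h01
  obtain ⟨mβ, mα⟩ := mem_coordinates le_rfl hfin
  -- The length `2 * (n + 1)` is even, positive and at least `n`, whatever the parity of `n`.
  refine ⟨T, D, 2 * (n + 1), q, V, Sum.inl ⟨0, m0⟩, Sum.inl ⟨1, m1⟩, Sum.inl ⟨β, mβ⟩,
    Sum.inl ⟨α, mα⟩, ⟨even_two_mul _, by omega, Label.value_nonneg, ?_, ?_,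
      fun k _ he a => hVE k a he, fun k _ ho b => hVO k b ho, ?_, ?_⟩, rfl, rfl⟩
  · simp [Label.value]
  · simp [Label.value]
  · rintro (⟨x, hx⟩ | i) (⟨y, hy⟩ | j)
    · have : q 0 (Sum.inl ⟨x, hx⟩) (Sum.inl ⟨y, hy⟩) = p 0 (x, y) := by
        simp [q, onLabelPairs, onLabels]
      rw [this, hp.init, Finsupp.add_apply, Finsupp.single_apply, Finsupp.single_apply]
      simp only [Prod.mk.injEq, Sum.inl.injEq, Subtype.mk.injEq]
      by_cases hx0 : x = 0
      · subst hx0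
        by_cases hy1 : y = 1
        · subst hy1; simp
        · simp [hy1, Ne.symm hy1]
      · by_cases hx1 : x = 1
        · subst hx1; simp [eq_comm]
        · simp [hx0, hx1, Ne.symm hx0, Ne.symm hx1]
    all_goals simp [q, onLabelPairs, onLabels]
  · have hn : min (2 * (n + 1)) n = n := min_eq_right (by omega)
    rintro (⟨x, hx⟩ | i) (⟨y, hy⟩ | j)
    · have : q (2 * (n + 1)) (Sum.inl ⟨x, hx⟩) (Sum.inl ⟨y, hy⟩) = p n (x, y) := by
        simp only [q, hn]
        rfl
      rw [this, hp.final, Finsupp.single_apply]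
      simp only [Prod.mk.injEq, Sum.inl.injEq, Subtype.mk.injEq, eq_comm]
    all_goals simp [q, onLabelPairs, onLabels]

end WCF

theorem mainTheorem3 (n : ℕ) (p : ℕ → (ℝ≥0 × ℝ≥0 →₀ ℝ≥0)) (β α : ℝ≥0)
    (hp : WCF.IsEBMPointGame n p β α) :
    ∃ (A M B : Type) (_ : Fintype A) (_ : Fintype M) (_ : Fintype B)
      (_ : DecidableEq A) (_ : DecidableEq M) (_ : DecidableEq B)
      (N : ℕ) (P : WCF.Scheme A M B) (ZA : ℕ → Matrix A A ℂ) (ZB : ℕ → Matrix B B ℂ),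
      P.IsProtocol N ∧
      P.DualFeasibleA N ZA (β : ℝ) ∧ P.DualFeasibleB N ZB (α : ℝ) ∧
      P.cheatA N ≤ ((α : ℝ) : EReal) ∧ P.cheatB N ≤ ((β : ℝ) : EReal) ∧
      P.primalValueA N ≤ ((α : ℝ) : EReal) ∧ P.primalValueB N ≤ ((β : ℝ) : EReal) := by
  obtain ⟨T, D, N, q, V, zero, one, a₀, b₀, h, ha, hb⟩ := hp.exists_isLabelGame
  have hP := h.isProtocol
  have hA := h.dualFeasibleA h.value_fst_pos
  have hB := h.dualFeasibleB h.value_snd_pos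
  rw [ha] at hA
  rw [hb] at hB
  exact ⟨_, _, _, _, _, _, _, _, _, N, _, _, _, hP, hA, hB,
    WCF.Scheme.cheatA_le_of_dualFeasibleB hP hB, WCF.Scheme.cheatB_le_of_dualFeasibleA hP hA,
    WCF.Scheme.primalValueA_le_of_dualFeasibleB hP hB,
    WCF.Scheme.primalValueB_le_of_dualFeasibleA hP hA⟩
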